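/- Let $n\ge 2$ and $\alpha\ge 0$. On $\mathbb C^n$ let $|\cdot|$ be the Euclidean norm and $|z|_\infty=\max_i|z_i|$, and let $\mathbb P^n=\{z\in\mathbb C^n:|z|_\infty<1\}$. For a locally biholomorphic $f=(f_1,\dots,f_n):\mathbb P^n\to\mathbb C^n$ let $J_f=\det Df$, $\nabla J_f=(\partial J_f/\partial z_1,\dots,\partial J_f/\partial z_n)$, $$S^k_{ij}f=\sum_{l=1}^n\frac{\partial^2 f_l}{\partial z_i\partial z_j}\frac{\partial z_k}{\partial f_l}-\frac1{n+1}\Big(\delta^k_i\frac{\partial}{\partial z_j}+\delta^k_j\frac{\partial}{\partial z_i}\Big)\log J_f ,$$ where $(\partial z_k/\partial f_l)_{k,l}=(Df)^{-1}$, and let $S_f(z)(v)\in\mathbb C^n$ be the vector with coordinates $\sum_{i,j}S^k_{ij}f(z)v_iv_j$, $k=1,\dots,n$. Put $\|S_f\|=\sup_{z\in\mathbb P^n}\sup_{\|v\|_z=1}\|S_f(z)(v)\|_z$, where $\|v\|_z=\big(2\sum_i|v_i|^2/(1-|z_i|^2)^2\big)^{1/2}$ is the Bergman norm at $z$. Let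 $\mathcal F_\alpha$ be the set of locally biholomorphic $f:\mathbb P^n\to\mathbb C^n$ with $f(0)=0$, $Df(0)=I$ and $\|S_f\|\le\alpha$, and let $\lambda_\alpha=\sup_{f\in\mathcal F_\alpha}|\nabla J_f(0)|$ be its order. For $f\in\mathcal F_\alpha$ put $a=\nabla J_f(0)/(n+1)$ and $g=T_a\circ f$, where $T_a(w)=w/(1+a_1w_1+\cdots+a_nw_n)$; this is the normalization of $f$ with $\nabla J_g(0)=0$, and $\mathcal F^0_\alpha$ is the set of all these (possibly meromorphic) mappings $g$. Let $s_0(n,\alpha)$ be the supremum of all $s$ such that, for every $g\in\mathcal F_\alpha^0$, every point of the open Euclidean ball of radius $s$ about $0$ is a (finite) value of $g$ on $\mathbb P^n$. **Theorem.** Let $f\in\mathcal F_\alpha$, $z\in\mathbb P^n$, $\beta=\alpha+2\sqrt2\,|z|_\infty$, and $\eta(z)=\min_{|v|=1}|Df(z)v|$. Then $s_0(n,\beta)>0$, and $f(\mathbb P^n)$ contains the open Euclidean ball about $f(z)$ of radius $$\tfrac12(1-|z|_\infty)\,\eta(z)\,s_0(n,\beta).$$ Moreover $\lambda_\beta<\infty$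 and $$|\nabla J_f(z)|_\infty\le\frac{\lambda_\beta+2|z|_\infty}{1-|z|_\infty^2}\,|J_f(z)| .$$ -/

import Mathlib

open scoped ENNReal

noncomputable section

namespace PolydiskSchwarzian

/-- Complex Euclidean space `ℂⁿ`; `‖z‖` is the Euclidean norm. -/
abbrev Cn (n : ℕ) : Type := EuclideanSpace ℂ (Fin n)

/-- The polydisk norm `max_i |z_i|`. -/
def supNorm {n : ℕ} (z : Cn n) : ℝ := ‖(fun i => z i : Fin n → ℂ)‖

/-- The unit polydisk. -/
def polydisk (n : ℕ) : Set (Cn n) := {z | ∀ i, ‖z i‖ < 1}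

/-- The complex partial derivative `∂h/∂z_i` at `z`. -/
def partialDeriv {n : ℕ} (i : Fin n) (h : Cn n → ℂ) (z : Cn n) : ℂ :=
  fderiv ℂ h z (EuclideanSpace.single i 1)

/-- The Jacobian matrix, with entry `∂f_l/∂z_i` in row `l` and column `i`. -/
def jacobianMatrix {n : ℕ} (f : Cn n → Cn n) (z : Cn n) : Matrix (Fin n) (Fin n) ℂ :=
  Matrix.of fun l i => partialDeriv i (fun w => f w l) z

/-- The complex Jacobian determinant `J_f`. -/
def jac {n : ℕ} (f : Cn n → Cn n) (z : Cn n) : ℂ := (jacobianMatrix f z).det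

/-- The holomorphic gradient `(∂J_f/∂z_1, …, ∂J_f/∂z_n)` of the Jacobian determinant. -/
def gradJac {n : ℕ} (f : Cn n → Cn n) (z : Cn n) : Cn n :=
  WithLp.toLp 2 fun i => partialDeriv i (jac f) z

/-- `f` is holomorphic on the polydisk, with nonvanishing Jacobian determinant there. -/
def IsLocallyBiholomorphic {n : ℕ} (f : Cn n → Cn n) : Prop :=
  AnalyticOnNhd ℂ f (polydisk n) ∧ ∀ z ∈ polydisk n, jac f z ≠ 0

/-- The Schwarzian derivative `S^k_{ij} f`, namely
`∑_l (∂²f_l/∂z_i∂z_j) (∂z_k/∂f_l) - (δ^k_i ∂_j + δ^k_j ∂_i) log J_f / (n + 1)`. The numbers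
`∂z_k/∂f_l` are the entries of the inverse Jacobian matrix, and `∂_j log J_f = (∂_j J_f) / J_f`. -/
def schwarzianCoeff {n : ℕ} (f : Cn n → Cn n) (k i j : Fin n) (z : Cn n) : ℂ :=
  ∑ l, partialDeriv i (fun w => partialDeriv j (fun x => f x l) w) z * (jacobianMatrix f z)⁻¹ k l
    - 1 / ((n : ℂ) + 1) *
      ((if k = i then partialDeriv j (jac f) z / jac f z else 0)
        + (if k = j then partialDeriv i (jac f) z / jac f z else 0))

/-- The Schwarzian derivative operator: the `k`-th coordinate of `S_f(z)(v)` is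
`∑_{i,j} S^k_{ij} f(z) v_i v_j`. -/
def schwarzian {n : ℕ} (f : Cn n → Cn n) (z v : Cn n) : Cn n :=
  WithLp.toLp 2 fun k => ∑ i, ∑ j, schwarzianCoeff f k i j z * v i * v j

/-- The Bergman norm of a tangent vector `v` at the point `z` of the polydisk. -/
def bergmanNorm {n : ℕ} (z v : Cn n) : ℝ :=
  Real.sqrt (2 * ∑ i, ‖v i‖ ^ 2 / (1 - ‖z i‖ ^ 2) ^ 2)

/-- The norm `‖S_f‖`, the supremum over all `z` in the polydisk and all `v` of Bergman norm `1`
at `z` of the Bergman norm of `S_f(z)(v)` at `z`; it takes values in `[0, ∞]`. -/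
def schwarzianNorm {n : ℕ} (f : Cn n → Cn n) : ℝ≥0∞ :=
  ⨆ z ∈ polydisk n, ⨆ v : Cn n, ⨆ _ : bergmanNorm z v = 1,
    ENNReal.ofReal (bergmanNorm z (schwarzian f z v))

/-- The family `F_α` (for `0 ≤ α`): locally biholomorphic mappings of the polydisk into `ℂⁿ` with
`f(0) = 0`, `Df(0) = I` and `‖S_f‖ ≤ α`. -/
def family (n : ℕ) (α : ℝ) : Set (Cn n → Cn n) :=
  {f | IsLocallyBiholomorphic f ∧ f 0 = 0 ∧ fderiv ℂ f 0 = ContinuousLinearMap.id ℂ (Cn n) ∧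
    schwarzianNorm f ≤ ENNReal.ofReal α}

/-- The set of the numbers `|∇J_f(0)|`, for `f` in `F_α`. -/
def orderSet (n : ℕ) (α : ℝ) : Set ℝ := (fun f => ‖gradJac f 0‖) '' family n α

/-- The order `λ_α = sup_{f ∈ F_α} |∇J_f(0)|`. -/
def order (n : ℕ) (α : ℝ) : ℝ := sSup (orderSet n α)

/-- The linear form `1 + a_1 w_1 + ⋯ + a_n w_n`. -/
def moebiusDenom {n : ℕ} (a w : Cn n) : ℂ := 1 + ∑ i, a i * w i

/-- The Möbius map `T_a(w) = w / (1 + a_1 w_1 + ⋯ + a_n w_n)`; it is finite where the denominator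
is nonzero. -/
def moebius {n : ℕ} (a w : Cn n) : Cn n := (moebiusDenom a w)⁻¹ • w

/-- The parameter `a = ∇J_f(0) / (n + 1)`, for which `g = T_a ∘ f` satisfies `∇J_g(0) = 0`
(when `f(0) = 0` and `Df(0) = I`). -/
def normalizingParam {n : ℕ} (f : Cn n → Cn n) : Cn n := (1 / ((n : ℂ) + 1)) • gradJac f 0

/-- The set of finite values on the polydisk of the normalized (meromorphic) mapping
`g = T_a ∘ f`, where `a = ∇J_f(0) / (n + 1)`. -/
def normalizedImage {n : ℕ} (f : Cn n → Cn n) : Set (Cn n) :=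
  {w | ∃ z ∈ polydisk n, moebiusDenom (normalizingParam f) (f z) ≠ 0 ∧
    moebius (normalizingParam f) (f z) = w}

/-- The constant `s₀(n, α)`: the largest `s` such that the Euclidean ball of radius `s` about the
origin is covered by every normalized mapping `g = T_a ∘ f`, `f ∈ F_α`. -/
def coveringRadius (n : ℕ) (α : ℝ) : ℝ :=
  sSup {s : ℝ | ∀ f ∈ family n α, Metric.ball 0 s ⊆ normalizedImage f}

/-- `η(z) = min_{|v| = 1} |Df(z) v|`. -/
def minStretch {n : ℕ} (f : Cn n → Cn n) (z : Cn n) : ℝ :=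
  sInf ((fun v => ‖fderiv ℂ f z v‖) '' Metric.sphere (0 : Cn n) 1)

end PolydiskSchwarzian

end

noncomputable section

namespace PolydiskSchwarzian

variable {n : ℕ}

/-! The functions `u` and `u * f_l`, where `u = J_f ^ (-1 / (n + 1))`, solve one linear second order
system whose coefficients are the `S^k_{ij}` and a zeroth order term `S⁰_{ij}`. The bound on `‖S_f‖`
controls the first on a small polydisk. For `n ≥ 2`, flatness of the connection pulled back by `f`
expresses the second through the `S^k_{ij}` and their first derivatives (`schwarzianZero_eq`), so
Cauchy's estimate controls it too. Hence on a ball depending only on `n` and `α` the solutions stay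
near their initial values. There `g = T_a ∘ f`, a quotient of solutions, has derivative near the
identity and covers a fixed ball, so `s₀ > 0` (`exists_ball_subset_normalizedImage`).

The finite values of `T_a ∘ f` avoid the hyperplane `∑ a_i y_i = 1`, at distance `1 / |a|` from the
origin. Therefore `|a| s₀ ≤ 1`, which makes the order finite; undoing `T_a` shows that `f` itself
covers the ball of radius `s₀ / 2`.

The general point `z` is moved to `0` by the Koebe transform `affineTransform`. Polydisk
automorphisms are Bergman isometries but not Möbius maps of `ℂⁿ`, so by the chain rule they
contribute a Schwarzian of their own, of norm at most `2√2 |z|_∞`; this is why `α` becomes `β`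
(`affineTransform_mem_family`). Both conclusions are the statements at the origin for the transform,
rewritten in terms of `f`. -/

theorem isOpen_polydisk (n : ℕ) : IsOpen (polydisk n) := by
  have : polydisk n = ⋂ i, {z : Cn n | ‖z i‖ < 1} := by
    ext z; simp [polydisk]
  rw [this]
  exact isOpen_iInter_of_finite fun i => isOpen_lt (by fun_prop) continuous_const

theorem zero_mem_polydisk (n : ℕ) : (0 : Cn n) ∈ polydisk n := fun i => by simp

theorem norm_coord_le_supNorm (z : Cn n) (i : Fin n) : ‖z i‖ ≤ supNorm z :=
  norm_le_pi_norm (fun i => z i : Fin n → ℂ) i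

theorem supNorm_nonneg (z : Cn n) : 0 ≤ supNorm z := norm_nonneg _

theorem supNorm_le {z : Cn n} {r : ℝ} (hr : 0 ≤ r) (h : ∀ i, ‖z i‖ ≤ r) : supNorm z ≤ r :=
  (pi_norm_le_iff_of_nonneg hr).2 h

theorem supNorm_lt_one {z : Cn n} (hz : z ∈ polydisk n) : supNorm z < 1 :=
  (pi_norm_lt_iff one_pos).2 hz

/-! ### Calculus of holomorphic partial derivatives -/

section PartialDeriv

variable {g h : Cn n → ℂ} {z : Cn n} {i j : Fin n}

theorem _root_.AnalyticAt.partialDeriv (hh : AnalyticAt ℂ h z) (i : Fin n) :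
    AnalyticAt ℂ (partialDeriv i h) z :=
  ((ContinuousLinearMap.apply ℂ ℂ (EuclideanSpace.single i (1 : ℂ) : Cn n)).analyticAt
    _).comp hh.fderiv

theorem analyticAt_coord (i : Fin n) (z : Cn n) : AnalyticAt ℂ (fun w : Cn n => w i) z :=
  (EuclideanSpace.proj i : Cn n →L[ℂ] ℂ).analyticAt z

theorem _root_.AnalyticAt.coord {f : Cn n → Cn n} (hf : AnalyticAt ℂ f z) (l : Fin n) :
    AnalyticAt ℂ (fun w => f w l) z :=
  (analyticAt_coord l (f z)).comp hf

theorem partialDeriv_congr (e : g =ᶠ[nhds z] h) : partialDeriv i g z = partialDeriv i h z := by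
  unfold partialDeriv
  rw [e.fderiv_eq]

theorem partialDeriv_add (hg : DifferentiableAt ℂ g z) (hh : DifferentiableAt ℂ h z) :
    partialDeriv i (fun w => g w + h w) z = partialDeriv i g z + partialDeriv i h z := by
  unfold partialDeriv
  rw [fderiv_fun_add hg hh]; rfl

theorem partialDeriv_sub (hg : DifferentiableAt ℂ g z) (hh : DifferentiableAt ℂ h z) :
    partialDeriv i (fun w => g w - h w) z = partialDeriv i g z - partialDeriv i h z := by
  unfold partialDeriv
  rw [fderiv_fun_sub hg hh]; rfl

theorem partialDeriv_mul (hg : DifferentiableAt ℂ g z) (hh : DifferentiableAt ℂ h z) :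
    partialDeriv i (fun w => g w * h w) z
      = partialDeriv i g z * h z + g z * partialDeriv i h z := by
  unfold partialDeriv
  rw [fderiv_fun_mul hg hh]
  simp only [add_apply, smul_apply, smul_eq_mul]
  ring

theorem partialDeriv_const (c : ℂ) : partialDeriv i (fun _ : Cn n => c) z = 0 := by
  unfold partialDeriv
  simp

theorem partialDeriv_const_mul (c : ℂ) (hh : DifferentiableAt ℂ h z) :
    partialDeriv i (fun w => c * h w) z = c * partialDeriv i h z := by
  rw [partialDeriv_mul (differentiableAt_const c) hh, partialDeriv_const]
  ring

theorem partialDeriv_sum {ι : Type*} (s : Finset ι) {G : ι → Cn n → ℂ}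
    (hG : ∀ a ∈ s, DifferentiableAt ℂ (G a) z) :
    partialDeriv i (fun w => ∑ a ∈ s, G a w) z = ∑ a ∈ s, partialDeriv i (G a) z := by
  unfold partialDeriv
  rw [fderiv_fun_sum hG, sum_apply]

theorem partialDeriv_inv (hh : DifferentiableAt ℂ h z) (h0 : h z ≠ 0) :
    partialDeriv i (fun w => (h w)⁻¹) z = - partialDeriv i h z / h z ^ 2 := by
  have := (hasDerivAt_inv h0).comp_hasFDerivAt z hh.hasFDerivAt
  have e : fderiv ℂ (fun w => (h w)⁻¹) z = _ := this.fderiv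
  unfold partialDeriv
  rw [e]
  simp only [smul_apply, smul_eq_mul]
  ring

theorem partialDeriv_div (hg : DifferentiableAt ℂ g z) (hh : DifferentiableAt ℂ h z)
    (h0 : h z ≠ 0) : partialDeriv i (fun w => g w / h w) z
      = (partialDeriv i g z * h z - g z * partialDeriv i h z) / h z ^ 2 := by
  simp only [div_eq_mul_inv]
  rw [partialDeriv_mul hg (hh.fun_inv h0), partialDeriv_inv hh h0]
  field_simp
  ring

theorem partialDeriv_coord (k : Fin n) :
    partialDeriv i (fun w : Cn n => w k) z = if k = i then 1 else 0 := by
  have : fderiv ℂ (fun w : Cn n => w k) z = (EuclideanSpace.proj k : Cn n →L[ℂ] ℂ) :=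
    (EuclideanSpace.proj k : Cn n →L[ℂ] ℂ).fderiv
  unfold partialDeriv
  rw [this]
  simp

theorem eq_sum_single (v : Cn n) : v = ∑ i, v i • (EuclideanSpace.single i (1 : ℂ) : Cn n) := by
  ext k
  simp [Pi.single_apply]

theorem fderiv_apply_eq_sum (h : Cn n → ℂ) (z v : Cn n) :
    fderiv ℂ h z v = ∑ i, v i * partialDeriv i h z := by
  conv_lhs => rw [eq_sum_single v]
  simp [map_sum, partialDeriv]

theorem partialDeriv_comm (hh : AnalyticAt ℂ h z) (i j : Fin n) :
    partialDeriv i (partialDeriv j h) z = partialDeriv j (partialDeriv i h) z := by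
  have key : ∀ a b : Fin n, partialDeriv a (partialDeriv b h) z
      = fderiv ℂ (fderiv ℂ h) z (EuclideanSpace.single a 1) (EuclideanSpace.single b 1) := by
    intro a b
    have h1 := (ContinuousLinearMap.apply ℂ ℂ
      (EuclideanSpace.single b (1 : ℂ) : Cn n)).hasFDerivAt.comp z
      hh.fderiv.differentiableAt.hasFDerivAt
    have e : fderiv ℂ (partialDeriv b h) z = _ := h1.fderiv
    rw [partialDeriv, e]
    rfl
  rw [key, key]
  exact (hh.contDiffAt (n := ⊤)).isSymmSndFDerivAt (by simp) _ _

theorem hasDerivAt_ray {t : ℂ} (hh : DifferentiableAt ℂ h (t • z)) :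
    HasDerivAt (fun s : ℂ => h (s • z)) (∑ i, z i * partialDeriv i h (t • z)) t := by
  rw [← fderiv_apply_eq_sum]
  have : HasDerivAt (fun s : ℂ => s • z) z t := by
    simpa using (hasDerivAt_id t).smul_const z
  exact hh.hasFDerivAt.comp_hasDerivAt t this

end PartialDeriv

/-! ### Analytic dependence of determinants and inverse matrices -/

section MatrixEntries

variable {A : Cn n → Matrix (Fin n) (Fin n) ℂ} {z : Cn n}

theorem analyticAt_det (hA : ∀ i j, AnalyticAt ℂ (fun w => A w i j) z) :
    AnalyticAt ℂ (fun w => (A w).det) z := by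
  simp only [Matrix.det_apply']
  exact Finset.analyticAt_fun_sum _ fun σ _ =>
    analyticAt_const.mul (Finset.analyticAt_fun_prod _ fun i _ => hA _ _)

theorem analyticAt_inv_apply (hA : ∀ i j, AnalyticAt ℂ (fun w => A w i j) z)
    (h0 : (A z).det ≠ 0) (i j : Fin n) : AnalyticAt ℂ (fun w => (A w)⁻¹ i j) z := by
  -- Cramer's rule turns the entry of the inverse into a quotient of determinants.
  have h1 : (fun w => (A w)⁻¹ i j)
      = fun w => ((A w).det)⁻¹ * ((A w).updateRow j (Pi.single i 1)).det := by
    funext w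
    rw [Matrix.inv_def, Matrix.smul_apply, Matrix.adjugate_apply, Ring.inverse_eq_inv', smul_eq_mul]
  rw [h1]
  refine ((analyticAt_det hA).inv h0).mul (analyticAt_det fun a b => ?_)
  by_cases h : a = j
  · subst h
    simpa using analyticAt_const
  · simpa [Matrix.updateRow_ne h] using hA a b

end MatrixEntries

/-! ### The pulled back flat connection and the Schwarzian coefficients -/

section Christoffel

variable {f : Cn n → Cn n} {z : Cn n}

/-- `∂_i log J_f / (n + 1)`. -/
def logJacGrad (f : Cn n → Cn n) (i : Fin n) (z : Cn n) : ℂ :=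
  1 / ((n : ℂ) + 1) * (partialDeriv i (jac f) z / jac f z)

/-- The Christoffel symbols `∑_l (∂²f_l/∂z_i∂z_j) (∂z_k/∂f_l)` of the flat connection pulled back
by `f`. -/
def christoffel (f : Cn n → Cn n) (k i j : Fin n) (z : Cn n) : ℂ :=
  ∑ l, partialDeriv i (fun w => partialDeriv j (fun x => f x l) w) z * (jacobianMatrix f z)⁻¹ k l

theorem schwarzianCoeff_eq (f : Cn n → Cn n) (k i j : Fin n) (z : Cn n) :
    schwarzianCoeff f k i j z = christoffel f k i j z
      - ((if k = i then logJacGrad f j z else 0) + (if k = j then logJacGrad f i z else 0)) := by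
  unfold schwarzianCoeff christoffel logJacGrad
  rw [mul_add, mul_ite, mul_ite, mul_zero]

theorem analyticAt_jacobianMatrix (hf : AnalyticAt ℂ f z) (i j : Fin n) :
    AnalyticAt ℂ (fun w => jacobianMatrix f w i j) z :=
  (hf.coord i).partialDeriv j

theorem analyticAt_jac (hf : AnalyticAt ℂ f z) : AnalyticAt ℂ (jac f) z :=
  analyticAt_det (analyticAt_jacobianMatrix hf)

theorem analyticAt_logJacGrad (hf : AnalyticAt ℂ f z) (h0 : jac f z ≠ 0) (i : Fin n) :
    AnalyticAt ℂ (logJacGrad f i) z :=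
  analyticAt_const.mul (((analyticAt_jac hf).partialDeriv i).div (analyticAt_jac hf) h0)

theorem analyticAt_christoffel (hf : AnalyticAt ℂ f z) (h0 : jac f z ≠ 0) (k i j : Fin n) :
    AnalyticAt ℂ (christoffel f k i j) z :=
  Finset.analyticAt_fun_sum _ fun l _ => (((hf.coord l).partialDeriv j).partialDeriv i).mul
    (analyticAt_inv_apply (analyticAt_jacobianMatrix hf) h0 k l)

theorem analyticAt_schwarzianCoeff (hf : AnalyticAt ℂ f z) (h0 : jac f z ≠ 0) (k i j : Fin n) :
    AnalyticAt ℂ (schwarzianCoeff f k i j) z := by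
  have : schwarzianCoeff f k i j = fun z => christoffel f k i j z
      - ((if k = i then logJacGrad f j z else 0) + (if k = j then logJacGrad f i z else 0)) :=
    funext (schwarzianCoeff_eq f k i j)
  rw [this]
  refine (analyticAt_christoffel hf h0 k i j).sub (AnalyticAt.add ?_ ?_) <;> split_ifs
  exacts [analyticAt_logJacGrad hf h0 j, analyticAt_const, analyticAt_logJacGrad hf h0 i,
    analyticAt_const]

theorem christoffel_symm (hf : AnalyticAt ℂ f z) (k i j : Fin n) :
    christoffel f k i j z = christoffel f k j i z :=
  Finset.sum_congr rfl fun l _ => congrArg (· * _) (partialDeriv_comm (hf.coord l) i j)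

theorem schwarzianCoeff_symm (hf : AnalyticAt ℂ f z) (k i j : Fin n) :
    schwarzianCoeff f k i j z = schwarzianCoeff f k j i z := by
  rw [schwarzianCoeff_eq, schwarzianCoeff_eq, christoffel_symm hf, add_comm]

/-- These functions form a constant multiple of the gradient of `log J_f`; the quotient rule proves
closedness without choosing a branch of the logarithm. -/
theorem logJacGrad_closed (hf : AnalyticAt ℂ f z) (h0 : jac f z ≠ 0) (i j : Fin n) :
    partialDeriv i (logJacGrad f j) z = partialDeriv j (logJacGrad f i) z := by
  have hJ := analyticAt_jac hf
  have key : ∀ a b : Fin n, partialDeriv a (logJacGrad f b) z = 1 / ((n : ℂ) + 1) *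
      ((partialDeriv a (partialDeriv b (jac f)) z * jac f z
        - partialDeriv b (jac f) z * partialDeriv a (jac f) z) / jac f z ^ 2) := by
    intro a b
    have hb := (hJ.partialDeriv b).differentiableAt
    have := partialDeriv_const_mul (i := a) (1 / ((n : ℂ) + 1))
      ((hJ.partialDeriv b).fun_div hJ h0).differentiableAt
    rw [partialDeriv_div hb hJ.differentiableAt h0] at this
    exact this
  rw [key, key, partialDeriv_comm hJ i j]
  ring

/-- Multiplying by the Jacobian matrix cancels the inverse in the Christoffel symbols. In geometric
terms, the coordinates of `f` are affine functions for the pulled back connection. -/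
theorem partialDeriv_partialDeriv_eq (h0 : jac f z ≠ 0) (l i j : Fin n) :
    partialDeriv i (partialDeriv j (fun x => f x l)) z
      = ∑ k, christoffel f k i j z * partialDeriv k (fun x => f x l) z := by
  have hdet : IsUnit (jacobianMatrix f z).det := isUnit_iff_ne_zero.2 h0
  simp only [christoffel, Finset.sum_mul]
  rw [Finset.sum_comm]
  have : ∀ m : Fin n, ∑ k, partialDeriv i (fun w => partialDeriv j (fun x => f x m) w) z
      * (jacobianMatrix f z)⁻¹ k m * partialDeriv k (fun x => f x l) z
      = partialDeriv i (fun w => partialDeriv j (fun x => f x m) w) z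
        * (if l = m then 1 else 0) := by
    intro m
    have e := congrFun (congrFun (Matrix.mul_nonsing_inv _ hdet) l) m
    rw [Matrix.mul_apply, Matrix.one_apply] at e
    rw [← e, Finset.mul_sum]
    refine Finset.sum_congr rfl fun k _ => ?_
    simp only [jacobianMatrix, Matrix.of_apply]
    ring
  simp [this]

/-- The flatness of the pulled back connection. -/
theorem christoffel_flat (hf : AnalyticAt ℂ f z) (h0 : jac f z ≠ 0) (m i j l : Fin n) :
    partialDeriv l (christoffel f m i j) z
        + ∑ k, christoffel f k i j z * christoffel f m l k z
      = partialDeriv j (christoffel f m i l) z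
        + ∑ k, christoffel f k i l z * christoffel f m j k z := by
  have hdet : IsUnit (jacobianMatrix f z).det := isUnit_iff_ne_zero.2 h0
  have hne : ∀ᶠ w in nhds z, jac f w ≠ 0 :=
    (analyticAt_jac hf).continuousAt.eventually_ne h0
  have third : ∀ q a b c : Fin n, partialDeriv a (partialDeriv b (partialDeriv c
      (fun x => f x q))) z = ∑ m, (partialDeriv a (christoffel f m b c) z
        + ∑ k, christoffel f k b c z * christoffel f m a k z)
          * partialDeriv m (fun x => f x q) z := by
    intro q a b c
    have e : partialDeriv b (partialDeriv c (fun x => f x q)) =ᶠ[nhds z]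
        fun w => ∑ k, christoffel f k b c w * partialDeriv k (fun x => f x q) w :=
      hne.mono fun w hw => partialDeriv_partialDeriv_eq hw q b c
    have d1 := fun k => (analyticAt_christoffel hf h0 k b c).differentiableAt
    have d2 := fun k => ((hf.coord q).partialDeriv k).differentiableAt
    rw [partialDeriv_congr e, partialDeriv_sum _ fun k _ => (d1 k).fun_mul (d2 k)]
    simp_rw [partialDeriv_mul (d1 _) (d2 _), partialDeriv_partialDeriv_eq h0 q, add_mul,
      Finset.sum_add_distrib, Finset.mul_sum, Finset.sum_mul]
    congr 1
    rw [Finset.sum_comm]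
    refine Finset.sum_congr rfl fun x _ => Finset.sum_congr rfl fun y _ => by ring
  set X : Fin n → ℂ := fun m => partialDeriv l (christoffel f m i j) z
        + ∑ k, christoffel f k i j z * christoffel f m l k z with hX
  set Y : Fin n → ℂ := fun m => partialDeriv j (christoffel f m i l) z
        + ∑ k, christoffel f k i l z * christoffel f m j k z with hY
  -- Both sides are the third derivatives of the coordinates of `f`, in the orders `l, i, j` and `j,
  -- i, l`; invertibility of the Jacobian matrix then gives `X = Y`.
  have hXY : (jacobianMatrix f z).mulVec X = (jacobianMatrix f z).mulVec Y := by
    funext q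
    have e1 : ∀ a b : Fin n, partialDeriv a (partialDeriv i (partialDeriv b (fun x => f x q))) z
        = partialDeriv a (partialDeriv b (partialDeriv i (fun x => f x q))) z := fun a b =>
      partialDeriv_congr ((hf.coord q).eventually_analyticAt.mono fun w hw =>
        partialDeriv_comm hw i b)
    have e2 := third q l i j
    rw [e1, partialDeriv_comm ((hf.coord q).partialDeriv i), ← e1, third] at e2
    simp only [Matrix.mulVec, dotProduct, jacobianMatrix, Matrix.of_apply, hX, hY]
    simp_rw [mul_comm (partialDeriv _ (fun w => f w q) z)]
    exact e2.symm
  have := congrArg (jacobianMatrix f z)⁻¹.mulVec hXY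
  simp only [Matrix.mulVec_mulVec, Matrix.nonsing_inv_mul _ hdet, Matrix.one_mulVec] at this
  exact congrFun this m

/-- The coefficient `S⁰_{ij}` of `u` in the system
`∂_i ∂_j u = ∑_k S^k_{ij} ∂_k u + S⁰_{ij} u` solved by `J_f ^ (-1 / (n + 1))`. -/
def schwarzianZero (f : Cn n → Cn n) (i j : Fin n) (z : Cn n) : ℂ :=
  logJacGrad f i z * logJacGrad f j z + ∑ k, schwarzianCoeff f k i j z * logJacGrad f k z
    - partialDeriv i (logJacGrad f j) z

theorem christoffel_eq (f : Cn n → Cn n) (k i j : Fin n) (z : Cn n) :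
    christoffel f k i j z = schwarzianCoeff f k i j z
      + ((if k = i then logJacGrad f j z else 0) + (if k = j then logJacGrad f i z else 0)) := by
  rw [schwarzianCoeff_eq]; ring

theorem partialDeriv_christoffel (hf : AnalyticAt ℂ f z) (h0 : jac f z ≠ 0) (k i j l : Fin n) :
    partialDeriv l (christoffel f k i j) z = partialDeriv l (schwarzianCoeff f k i j) z
      + ((if k = i then partialDeriv l (logJacGrad f j) z else 0)
        + (if k = j then partialDeriv l (logJacGrad f i) z else 0)) := by
  have hS := (analyticAt_schwarzianCoeff hf h0 k i j).differentiableAt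
  have hp := fun a => (analyticAt_logJacGrad hf h0 a).differentiableAt
  have e : christoffel f k i j = _ := funext (christoffel_eq f k i j)
  have hi : DifferentiableAt ℂ (fun w => if k = i then logJacGrad f j w else 0) z := by
    split_ifs
    exacts [hp j, differentiableAt_const _]
  have hj : DifferentiableAt ℂ (fun w => if k = j then logJacGrad f i w else 0) z := by
    split_ifs
    exacts [hp i, differentiableAt_const _]
  rw [e, partialDeriv_add hS (hi.fun_add hj), partialDeriv_add hi hj]
  congr 2 <;> split_ifs
  exacts [rfl, partialDeriv_const _, rfl, partialDeriv_const _]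

/-- The definition of `schwarzianZero` involves `logJacGrad`, which `‖S_f‖` does not bound directly.
Flatness with upper index `l ≠ j` eliminates it; such an `l` exists because `n ≥ 2`. -/
theorem schwarzianZero_eq (hf : AnalyticAt ℂ f z) (h0 : jac f z ≠ 0) {i j l : Fin n}
    (hlj : l ≠ j) : schwarzianZero f i j z =
      partialDeriv j (schwarzianCoeff f l i l) z - partialDeriv l (schwarzianCoeff f l i j) z
        + ∑ k, (schwarzianCoeff f k i l z * schwarzianCoeff f l j k z
          - schwarzianCoeff f k i j z * schwarzianCoeff f l l k z) := by
  have flat := christoffel_flat hf h0 l i j l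
  rw [partialDeriv_christoffel hf h0, partialDeriv_christoffel hf h0] at flat
  simp only [christoffel_eq f _ _ _ z, if_neg hlj, if_true, mul_add, add_mul, mul_ite, ite_mul,
    mul_zero, zero_mul, Finset.sum_add_distrib, Finset.sum_ite_eq, Finset.sum_ite_eq',
    Finset.mem_univ] at flat
  have closed := logJacGrad_closed hf h0 j l
  have closed' := logJacGrad_closed hf h0 i j
  have symm := schwarzianCoeff_symm hf l i j
  have symm' := schwarzianCoeff_symm hf l i l
  have symm'' := schwarzianCoeff_symm hf l l j
  unfold schwarzianZero
  rw [Finset.sum_sub_distrib, closed']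
  by_cases hil : l = i
  · subst hil
    simp only [if_true, Finset.sum_const_zero, ← closed, symm''] at flat ⊢
    linear_combination flat
  · simp only [if_neg hil, Finset.sum_const_zero, symm, symm', symm''] at flat ⊢
    linear_combination flat

end Christoffel

/-! ### The linear system along complex lines through the origin -/

/-- A linear differential inequality keeps a curve close to its initial value. -/
theorem norm_sub_initial_le {E : Type*} [NormedAddCommGroup E] [NormedSpace ℂ E]
    {Y Y' : ℂ → E} {K : ℝ} (hK : K ≤ 1 / 2) (hK0 : 0 ≤ K)
    (hY : ∀ t ∈ Metric.closedBall (0 : ℂ) 1, HasDerivAt Y (Y' t) t)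
    (hb : ∀ t ∈ Metric.closedBall (0 : ℂ) 1, ‖Y' t‖ ≤ K * ‖Y t‖) {t : ℂ}
    (ht : t ∈ Metric.closedBall (0 : ℂ) 1) : ‖Y t - Y 0‖ ≤ 2 * K * ‖Y 0‖ := by
  have hc : ContinuousOn (fun t => ‖Y t‖) (Metric.closedBall (0 : ℂ) 1) := fun t ht =>
    (hY t ht).continuousAt.norm.continuousWithinAt
  have h0 : (0 : ℂ) ∈ Metric.closedBall (0 : ℂ) 1 := by simp
  -- The mean value inequality bounds the displacement by `K` times the maximum of `‖Y‖`; as `K ≤ 1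
  -- / 2`, that maximum is at most `2 * ‖Y 0‖`.
  obtain ⟨s, hs, hmax⟩ := (isCompact_closedBall (0 : ℂ) 1).exists_isMaxOn ⟨0, h0⟩ hc
  have step : ∀ t ∈ Metric.closedBall (0 : ℂ) 1, ‖Y t - Y 0‖ ≤ K * ‖Y s‖ := by
    intro t ht
    have := (convex_closedBall (0 : ℂ) 1).norm_image_sub_le_of_norm_hasDerivWithin_le
      (fun x hx => (hY x hx).hasDerivWithinAt)
      (fun x hx => (hb x hx).trans (mul_le_mul_of_nonneg_left (hmax hx) hK0)) h0 ht
    refine this.trans ?_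
    have h1 : ‖t - 0‖ ≤ 1 := by simpa using ht
    exact mul_le_of_le_one_right (by positivity) h1
  have h2 : ‖Y s‖ ≤ 2 * ‖Y 0‖ := by
    have h3 := step s hs
    have h4 := norm_sub_norm_le (Y s) (Y 0)
    nlinarith [norm_nonneg (Y s)]
  calc ‖Y t - Y 0‖ ≤ K * ‖Y s‖ := step t ht
    _ ≤ K * (2 * ‖Y 0‖) := by gcongr
    _ = _ := by ring

theorem ray_mem_polydisk {ζ : Cn n} {r R : ℝ} (hζ : ∀ i, ‖ζ i‖ ≤ r) (hR : 0 ≤ R)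
    (hr : R * r < 1) {t : ℂ} (ht : ‖t‖ ≤ R) : t • ζ ∈ polydisk n := by
  intro i
  rw [PiLp.smul_apply, norm_smul]
  exact (mul_le_mul ht (hζ i) (norm_nonneg _) hR).trans_lt hr

/-- `exp (-∫ ∑ i, p i dz i)` along a complex line through the origin, where `p` is
`logJacGrad f`. -/
theorem exists_integratingFactor {f : Cn n → Cn n} (hf : IsLocallyBiholomorphic f) {ζ : Cn n}
    (hζ : ∀ i, ‖ζ i‖ ≤ 1 / 4) : ∃ u : ℂ → ℂ, u 0 = 1 ∧ (∀ t, u t ≠ 0) ∧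
      ∀ t ∈ Metric.closedBall (0 : ℂ) 1,
        HasDerivAt u (-(∑ i, ζ i * logJacGrad f i (t • ζ)) * u t) t := by
  -- Radius `2` leaves room around the closed unit disk, and `2 * (1 / 4) < 1` keeps the points in
  -- the polydisk. A primitive on this disk replaces a branch of `J_f ^ (-1 / (n + 1))`.
  have hd : DifferentiableOn ℂ (fun t : ℂ => ∑ i, ζ i * logJacGrad f i (t • ζ))
      (Metric.ball 0 2) := by
    intro t ht
    have hm : t • ζ ∈ polydisk n :=
      ray_mem_polydisk hζ (by norm_num) (by norm_num) (mem_ball_zero_iff.1 ht).le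
    refine DifferentiableAt.differentiableWithinAt (DifferentiableAt.fun_sum fun i _ => ?_)
    exact (hasDerivAt_ray (analyticAt_logJacGrad (hf.1 _ hm) (hf.2 _ hm) i).differentiableAt
      ).differentiableAt.const_mul _
  obtain ⟨P, hP⟩ := hd.isExactOn_ball
  refine ⟨fun t => Complex.exp (-(P t - P 0)), by simp, fun t => Complex.exp_ne_zero _, ?_⟩
  intro t ht
  have := ((hP t (Metric.closedBall_subset_ball (by norm_num) ht)).sub_const (P 0)).fun_neg.cexp
  exact this.congr_deriv (by ring)

/-- `A` is a solution of the linear system of which the coordinates of `f` are solutions. -/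
def IsFlatFunction (f : Cn n → Cn n) (A : Cn n → ℂ) : Prop :=
  ∀ w ∈ polydisk n, AnalyticAt ℂ A w ∧
    ∀ i k, partialDeriv i (partialDeriv k A) w = ∑ m, christoffel f m i k w * partialDeriv m A w

theorem isFlatFunction_coord {f : Cn n → Cn n} (hf : IsLocallyBiholomorphic f) (l : Fin n) :
    IsFlatFunction f (fun w => f w l) := fun w hw =>
  ⟨(hf.1 w hw).coord l, fun i k => partialDeriv_partialDeriv_eq (hf.2 w hw) l i k⟩

theorem isFlatFunction_const (f : Cn n → Cn n) (c : ℂ) : IsFlatFunction f (fun _ => c) := by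
  intro w hw
  refine ⟨analyticAt_const, fun i k => ?_⟩
  have : partialDeriv k (fun _ : Cn n => c) = fun _ => 0 := funext fun _ => partialDeriv_const c
  simp [this, partialDeriv_const]

theorem IsFlatFunction.add {f : Cn n → Cn n} {A B : Cn n → ℂ} (hA : IsFlatFunction f A)
    (hB : IsFlatFunction f B) : IsFlatFunction f (fun w => A w + B w) := by
  intro w hw
  have e : ∀ k, ∀ w ∈ polydisk n, partialDeriv k (fun w => A w + B w) w
      = partialDeriv k A w + partialDeriv k B w := fun k w hw =>
    partialDeriv_add (hA w hw).1.differentiableAt (hB w hw).1.differentiableAt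
  refine ⟨(hA w hw).1.fun_add (hB w hw).1, fun i k => ?_⟩
  have e2 := partialDeriv_congr (i := i)
    (Filter.eventuallyEq_of_mem ((isOpen_polydisk n).mem_nhds hw) (e k))
  rw [e2, partialDeriv_add ((hA w hw).1.partialDeriv k).differentiableAt
    ((hB w hw).1.partialDeriv k).differentiableAt, (hA w hw).2, (hB w hw).2,
    ← Finset.sum_add_distrib]
  simp only [e _ w hw, mul_add]

theorem IsFlatFunction.const_mul {f : Cn n → Cn n} {A : Cn n → ℂ} (hA : IsFlatFunction f A)
    (c : ℂ) : IsFlatFunction f (fun w => c * A w) := by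
  intro w hw
  have e : ∀ k, ∀ w ∈ polydisk n, partialDeriv k (fun w => c * A w) w
      = c * partialDeriv k A w := fun k w hw =>
    partialDeriv_const_mul c (hA w hw).1.differentiableAt
  refine ⟨analyticAt_const.fun_mul (hA w hw).1, fun i k => ?_⟩
  have e2 := partialDeriv_congr (i := i)
    (Filter.eventuallyEq_of_mem ((isOpen_polydisk n).mem_nhds hw) (e k))
  rw [e2, partialDeriv_const_mul c ((hA w hw).1.partialDeriv k).differentiableAt, (hA w hw).2,
    Finset.mul_sum]
  refine Finset.sum_congr rfl fun m _ => ?_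
  rw [e m w hw]
  ring

theorem IsFlatFunction.sum {f : Cn n → Cn n} {ι : Type*} (s : Finset ι) {A : ι → Cn n → ℂ}
    (hA : ∀ a, IsFlatFunction f (A a)) : IsFlatFunction f (fun w => ∑ a ∈ s, A a w) := by
  classical
  induction s using Finset.induction_on with
  | empty => simpa using isFlatFunction_const f 0
  | insert a s ha ih =>
    simp only [Finset.sum_insert ha]
    exact (hA a).add ih

/-- The value and the gradient of `u * A` at `w`, where `u` is a multiple `c` of
`J_f ^ (-1 / (n + 1))`. -/
def jet (f : Cn n → Cn n) (c : ℂ) (A : Cn n → ℂ) (w : Cn n) : ℂ × (Fin n → ℂ) :=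
  (c * A w, fun k => c * (partialDeriv k A w - logJacGrad f k w * A w))

/-- Along a line, the jets of solutions obey a linear system, with coefficients given by the
Schwarzian derivative. -/
theorem hasDerivAt_jet {f : Cn n → Cn n} (hf : IsLocallyBiholomorphic f) {A : Cn n → ℂ}
    (hA : IsFlatFunction f A) {ζ : Cn n} {u : ℂ → ℂ} {t : ℂ} (hm : t • ζ ∈ polydisk n)
    (hu : HasDerivAt u (-(∑ i, ζ i * logJacGrad f i (t • ζ)) * u t) t) :
    HasDerivAt (fun s => jet f (u s) A (s • ζ))
      (∑ k, ζ k * (jet f (u t) A (t • ζ)).2 k, fun k => ∑ i, ζ i *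
        (∑ m, schwarzianCoeff f m i k (t • ζ) * (jet f (u t) A (t • ζ)).2 m
          + schwarzianZero f i k (t • ζ) * (jet f (u t) A (t • ζ)).1)) t := by
  have hAr := hasDerivAt_ray (hA _ hm).1.differentiableAt
  have han := hf.1 _ hm
  have h0 := hf.2 _ hm
  unfold jet
  refine HasDerivAt.prodMk ?_ (hasDerivAt_pi.2 fun k => ?_)
  · refine (hu.fun_mul hAr).congr_deriv ?_
    simp only [neg_mul, Finset.sum_mul, Finset.mul_sum]
    rw [← Finset.sum_neg_distrib, ← Finset.sum_add_distrib]
    exact Finset.sum_congr rfl fun i _ => by ring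
  · have hp := hasDerivAt_ray (analyticAt_logJacGrad han h0 k).differentiableAt
    have hAk := hasDerivAt_ray ((hA _ hm).1.partialDeriv k).differentiableAt
    refine (hu.fun_mul (hAk.fun_sub (hp.fun_mul hAr))).congr_deriv ?_
    simp only [neg_mul, Finset.sum_mul]
    rw [Finset.mul_sum (Finset.univ) _ (logJacGrad f k (t • ζ)),
      ← Finset.sum_add_distrib, ← Finset.sum_sub_distrib, Finset.mul_sum,
      ← Finset.sum_neg_distrib, ← Finset.sum_add_distrib]
    refine Finset.sum_congr rfl fun i _ => ?_
    rw [(hA _ hm).2 i k]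
    -- The `δ`-terms of the Christoffel symbols cancel the first order terms coming from the
    -- derivatives of `u` and of `logJacGrad * A`; the remaining multiple of `A` assembles into
    -- `schwarzianZero`.
    simp only [christoffel_eq, add_mul, ite_mul, zero_mul, Finset.sum_add_distrib,
      Finset.sum_ite_eq', Finset.mem_univ, if_true, schwarzianZero]
    have e : ∑ m, schwarzianCoeff f m i k (t • ζ) *
        (u t * (partialDeriv m A (t • ζ) - logJacGrad f m (t • ζ) * A (t • ζ)))
        = u t * (∑ m, schwarzianCoeff f m i k (t • ζ) * partialDeriv m A (t • ζ)
          - (∑ m, schwarzianCoeff f m i k (t • ζ) * logJacGrad f m (t • ζ)) * A (t • ζ)) := by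
      rw [Finset.sum_mul, ← Finset.sum_sub_distrib, Finset.mul_sum]
      exact Finset.sum_congr rfl fun m _ => by ring
    rw [e]
    ring

/-- On a small ball, the jet of a solution is close to its value at the origin. -/
theorem exists_norm_jet_sub_le {f : Cn n → Cn n} (hf : IsLocallyBiholomorphic f) {C r : ℝ}
    (hC : 0 ≤ C)
    (hS : ∀ w : Cn n, (∀ i, ‖w i‖ ≤ 1 / 4) → ∀ k i j, ‖schwarzianCoeff f k i j w‖ ≤ C)
    (hS0 : ∀ w : Cn n, (∀ i, ‖w i‖ ≤ 1 / 4) → ∀ i j, ‖schwarzianZero f i j w‖ ≤ C)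
    (hr : r ≤ 1 / 4) (hr0 : 0 ≤ r) (hK : n * r * (n * C + C + 1) ≤ 1 / 2)
    {ζ : Cn n} (hζ : ∀ i, ‖ζ i‖ ≤ r) :
    ∃ c : ℂ, c ≠ 0 ∧ ∀ A, IsFlatFunction f A →
      ‖jet f c A ζ - jet f 1 A 0‖ ≤ 2 * (n * r * (n * C + C + 1)) * ‖jet f 1 A 0‖ := by
  obtain ⟨u, hu0, hune, hu⟩ := exists_integratingFactor hf fun i => (hζ i).trans hr
  refine ⟨u 1, hune 1, fun A hA => ?_⟩
  have hm : ∀ t ∈ Metric.closedBall (0 : ℂ) 1, t • ζ ∈ polydisk n := fun t ht =>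
    ray_mem_polydisk hζ zero_le_one (by linarith) (by simpa using ht)
  have := norm_sub_initial_le (Y := fun s => jet f (u s) A (s • ζ)) hK (by positivity)
    (fun t ht => hasDerivAt_jet hf hA (hm t ht) (hu t ht)) (fun t ht => ?_)
    (t := 1) (by simp)
  · simpa [hu0] using this
  · have hw : ∀ i, ‖(t • ζ) i‖ ≤ 1 / 4 := by
      intro i
      rw [PiLp.smul_apply, norm_smul]
      have h1 : ‖t‖ ≤ 1 := by simpa using ht
      exact (mul_le_of_le_one_left (norm_nonneg _) h1).trans ((hζ i).trans hr)
    set y := jet f (u t) A (t • ζ) with hy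
    have y1 : ‖y.1‖ ≤ ‖y‖ := norm_fst_le y
    have y2 : ∀ k, ‖y.2 k‖ ≤ ‖y‖ := fun k => (norm_le_pi_norm y.2 k).trans (norm_snd_le y)
    have card : ∀ a : ℝ, ∑ _i : Fin n, a = n * a := fun a => by simp
    -- The value component is bounded by `n * r * ‖y‖` and each gradient component by `n * r * (n *
    -- C + C) * ‖y‖`; the constant is the sum of the two.
    refine norm_prod_le_iff.2 ⟨?_, (pi_norm_le_iff_of_nonneg (by positivity)).2 fun k => ?_⟩
    · dsimp only
      refine (norm_sum_le _ _).trans ?_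
      refine (Finset.sum_le_sum (g := fun _ => r * ‖y‖) fun k _ => ?_).trans ?_
      · rw [norm_mul]
        exact mul_le_mul (hζ k) (y2 k) (norm_nonneg _) hr0
      · rw [card]
        nlinarith [show 0 ≤ (n : ℝ) * r * ‖y‖ * (n * C + C) by positivity]
    · dsimp only
      refine (norm_sum_le _ _).trans ?_
      refine (Finset.sum_le_sum (g := fun _ => r * (n * (C * ‖y‖) + C * ‖y‖))
        fun i _ => ?_).trans ?_
      · rw [norm_mul]
        refine mul_le_mul (hζ i) ?_ (norm_nonneg _) hr0
        refine (norm_add_le _ _).trans (add_le_add ((norm_sum_le _ _).trans ?_) ?_)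
        · rw [← card]
          refine Finset.sum_le_sum fun m _ => ?_
          rw [norm_mul]
          exact mul_le_mul (hS _ hw _ _ _) (y2 m) (norm_nonneg _) hC
        · rw [norm_mul]
          exact mul_le_mul (hS0 _ hw _ _) y1 (norm_nonneg _) hC
      · rw [card]
        nlinarith [show 0 ≤ (n : ℝ) * r * ‖y‖ by positivity]

/-- Cauchy's estimate for a partial derivative. -/
theorem norm_partialDeriv_le {h : Cn n → ℂ} (hh : AnalyticOnNhd ℂ h (polydisk n)) {C : ℝ}
    (hC : ∀ w : Cn n, (∀ i, ‖w i‖ ≤ 1 / 2) → ‖h w‖ ≤ C) {w : Cn n} (hw : ∀ i, ‖w i‖ ≤ 1 / 4)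
    (j : Fin n) : ‖partialDeriv j h w‖ ≤ 4 * C := by
  set e : Cn n := EuclideanSpace.single j 1 with he
  -- The disk of radius `1 / 4` in direction `j` stays where `h` is bounded by `C`; its radius
  -- produces the factor `4`.
  have hb : ∀ t : ℂ, ‖t‖ ≤ 1 / 4 → ∀ i, ‖(w + t • e) i‖ ≤ 1 / 2 := by
    intro t ht i
    have h1 : ‖e i‖ ≤ 1 := by
      rw [he]
      by_cases hij : i = j
      · subst hij; simp
      · simp [hij]
    have : ‖(w + t • e) i‖ ≤ ‖w i‖ + ‖t‖ * ‖e i‖ := by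
      rw [← norm_mul]
      exact norm_add_le _ _
    nlinarith [hw i, norm_nonneg t]
  have hder : ∀ t : ℂ, ‖t‖ ≤ 1 / 4 →
      HasDerivAt (fun s : ℂ => h (w + s • e)) (fderiv ℂ h (w + t • e) e) t := by
    intro t ht
    have hp : w + t • e ∈ polydisk n := fun i => (hb t ht i).trans_lt (by norm_num)
    have h2 : HasDerivAt (fun s : ℂ => w + s • e) e t := by
      simpa using ((hasDerivAt_id t).smul_const e).const_add w
    exact (hh _ hp).differentiableAt.hasFDerivAt.comp_hasDerivAt t h2
  have hdiff : DiffContOnCl ℂ (fun s : ℂ => h (w + s • e)) (Metric.ball 0 (1 / 4)) := by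
    refine DifferentiableOn.diffContOnCl fun t ht => ?_
    rw [closure_ball _ (by norm_num)] at ht
    exact (hder t (by simpa using ht)).differentiableAt.differentiableWithinAt
  have key := Complex.norm_deriv_le_of_forall_mem_sphere_norm_le (C := C) (by norm_num) hdiff
    (fun t ht => hC _ (hb t (mem_sphere_zero_iff_norm.1 ht).le))
  rw [(hder 0 (by simp)).deriv] at key
  simp only [zero_smul, add_zero] at key
  refine key.trans (le_of_eq ?_)
  ring

/-! ### Bergman norm and bounds for the coefficients of the linear system -/

section Bergman

/-- The Bergman norm at `z` is the Euclidean norm after rescaling the coordinates. -/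
def bergmanScale (z v : Cn n) : Cn n :=
  WithLp.toLp 2 fun i => ((Real.sqrt 2 / (1 - ‖z i‖ ^ 2) : ℝ) : ℂ) * v i

theorem bergmanNorm_eq (z v : Cn n) : bergmanNorm z v = ‖bergmanScale z v‖ := by
  rw [EuclideanSpace.norm_eq, bergmanNorm, Finset.mul_sum]
  congr 1
  refine Finset.sum_congr rfl fun i _ => ?_
  simp only [bergmanScale, norm_mul, Complex.norm_real, mul_pow, Real.norm_eq_abs, sq_abs, div_pow,
    Real.sq_sqrt (show (0 : ℝ) ≤ 2 by norm_num)]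
  ring

theorem bergmanNorm_nonneg (z v : Cn n) : 0 ≤ bergmanNorm z v := Real.sqrt_nonneg _

theorem bergmanNorm_smul (z : Cn n) (c : ℂ) (v : Cn n) :
    bergmanNorm z (c • v) = ‖c‖ * bergmanNorm z v := by
  rw [bergmanNorm_eq, bergmanNorm_eq, ← norm_smul]
  congr 1
  ext i
  simp only [bergmanScale, PiLp.smul_apply, smul_eq_mul]
  ring

theorem bergmanNorm_add_le (z v w : Cn n) :
    bergmanNorm z (v + w) ≤ bergmanNorm z v + bergmanNorm z w := by
  simp only [bergmanNorm_eq]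
  refine le_trans (le_of_eq ?_) (norm_add_le _ _)
  congr 1
  ext i
  simp only [bergmanScale, PiLp.add_apply]
  ring

theorem one_sub_sq_pos {z : Cn n} (hz : z ∈ polydisk n) (i : Fin n) : 0 < 1 - ‖z i‖ ^ 2 := by
  nlinarith [hz i, norm_nonneg (z i)]

theorem norm_coord_le_bergmanNorm {z : Cn n} (hz : z ∈ polydisk n) (v : Cn n) (i : Fin n) :
    ‖v i‖ ≤ bergmanNorm z v := by
  rw [bergmanNorm_eq]
  refine le_trans ?_ (PiLp.norm_apply_le _ i)
  have h1 := one_sub_sq_pos hz i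
  simp only [bergmanScale, norm_mul, Complex.norm_real, Real.norm_eq_abs]
  rw [abs_of_nonneg (by positivity)]
  refine le_mul_of_one_le_left (norm_nonneg _) ?_
  rw [one_le_div h1]
  nlinarith [Real.one_le_sqrt.2 (show (1 : ℝ) ≤ 2 by norm_num), sq_nonneg ‖z i‖]

theorem schwarzian_smul (f : Cn n → Cn n) (z : Cn n) (c : ℂ) (v : Cn n) :
    schwarzian f z (c • v) = c ^ 2 • schwarzian f z v := by
  ext k
  simp only [schwarzian, PiLp.smul_apply, smul_eq_mul, Finset.mul_sum]
  exact Finset.sum_congr rfl fun i _ => Finset.sum_congr rfl fun j _ => by ring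

theorem schwarzianNorm_le_iff {f : Cn n → Cn n} {α : ℝ} (hα : 0 ≤ α) :
    schwarzianNorm f ≤ ENNReal.ofReal α ↔
      ∀ z ∈ polydisk n, ∀ v, bergmanNorm z v = 1 → bergmanNorm z (schwarzian f z v) ≤ α := by
  simp only [schwarzianNorm, iSup_le_iff, ENNReal.ofReal_le_ofReal_iff hα]

/-- The Schwarzian is quadratic in `v`, so the bound on unit vectors scales. -/
theorem bergmanNorm_schwarzian_le {f : Cn n → Cn n} {α : ℝ} (hα : 0 ≤ α)
    (hf : f ∈ family n α) {z : Cn n} (hz : z ∈ polydisk n) (v : Cn n) :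
    bergmanNorm z (schwarzian f z v) ≤ α * bergmanNorm z v ^ 2 := by
  have h := (schwarzianNorm_le_iff hα).1 hf.2.2.2 z hz
  rcases (bergmanNorm_nonneg z v).eq_or_lt with h0 | hpos
  · have hv : v = 0 := by
      ext i
      have := norm_coord_le_bergmanNorm hz v i
      rw [← h0] at this
      simpa using this
    have : schwarzian f z v = (0 : ℂ) • schwarzian f z 0 := by
      rw [hv]
      ext k
      simp [schwarzian]
    rw [this, bergmanNorm_smul]
    simp only [norm_zero, zero_mul]
    positivity
  · set b := bergmanNorm z v with hb
    have h1 := h (((b⁻¹ : ℝ) : ℂ) • v) (by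
      rw [bergmanNorm_smul, Complex.norm_real, Real.norm_eq_abs, abs_of_pos (by positivity), ← hb,
        inv_mul_cancel₀ hpos.ne'])
    rw [schwarzian_smul, bergmanNorm_smul, norm_pow, Complex.norm_real, Real.norm_eq_abs,
      abs_of_pos (by positivity), inv_pow, inv_mul_le_iff₀ (by positivity)] at h1
    linarith

theorem bergmanNorm_sq_le {z : Cn n} (hz : ∀ i, ‖z i‖ ≤ 1 / 2) (v : Cn n) :
    bergmanNorm z v ^ 2 ≤ 4 * ‖v‖ ^ 2 := by
  rw [bergmanNorm, Real.sq_sqrt (by positivity), EuclideanSpace.norm_sq_eq, Finset.mul_sum,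
    Finset.mul_sum]
  refine Finset.sum_le_sum fun i _ => ?_
  have h1 : 3 / 4 ≤ 1 - ‖z i‖ ^ 2 := by nlinarith [hz i, norm_nonneg (z i)]
  have h2 : (1 : ℝ) / 2 ≤ (1 - ‖z i‖ ^ 2) ^ 2 := by nlinarith
  have : ‖v i‖ ^ 2 / (1 - ‖z i‖ ^ 2) ^ 2 ≤ 2 * ‖v i‖ ^ 2 := by
    rw [div_le_iff₀ (by positivity)]
    nlinarith [sq_nonneg ‖v i‖]
  linarith

theorem schwarzian_single_add (f : Cn n → Cn n) (z : Cn n) (i j k : Fin n) (s : ℂ) :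
    schwarzian f z (EuclideanSpace.single i 1 + s • EuclideanSpace.single j 1) k
      = schwarzianCoeff f k i i z + s * schwarzianCoeff f k i j z + s * schwarzianCoeff f k j i z
        + s ^ 2 * schwarzianCoeff f k j j z := by
  have e : ∀ a, (EuclideanSpace.single i 1 + s • EuclideanSpace.single j 1 : Cn n) a
      = (if a = i then 1 else 0) + s * (if a = j then 1 else 0) := by
    intro a
    simp
  simp only [schwarzian, e, mul_add, add_mul, mul_ite, ite_mul, mul_one, mul_zero, zero_mul,
    Finset.sum_add_distrib, Finset.sum_ite_eq', Finset.mem_univ, if_true]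
  ring

/-- Polarization: by symmetry in `i, j`, the values at `e_i + e_j` and `e_i - e_j` differ by four
times the coefficient. Each is at most `16 * α`, since these vectors have Euclidean norm at most `2`
and the squared Bergman norm is at most `4` times the squared Euclidean one. -/
theorem norm_schwarzianCoeff_le {f : Cn n → Cn n} {α : ℝ} (hα : 0 ≤ α) (hf : f ∈ family n α)
    {z : Cn n} (hz : ∀ i, ‖z i‖ ≤ 1 / 2) (k i j : Fin n) :
    ‖schwarzianCoeff f k i j z‖ ≤ 8 * α := by
  have hzp : z ∈ polydisk n := fun i => (hz i).trans_lt (by norm_num)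
  have hb : ∀ s : ℂ, ‖s‖ = 1 → ‖schwarzian f z
      (EuclideanSpace.single i 1 + s • EuclideanSpace.single j 1) k‖ ≤ 16 * α := by
    intro s hs
    set v : Cn n := EuclideanSpace.single i 1 + s • EuclideanSpace.single j 1 with hv
    have h1 : ‖v‖ ≤ 2 := by
      refine (norm_add_le _ _).trans ?_
      rw [norm_smul, hs]
      simp
      norm_num
    have h2 := (norm_coord_le_bergmanNorm hzp (schwarzian f z v) k).trans
      (bergmanNorm_schwarzian_le hα hf hzp v)
    have h3 : bergmanNorm z v ^ 2 ≤ 16 := by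
      nlinarith [bergmanNorm_sq_le hz v, norm_nonneg v]
    nlinarith
  have e : schwarzianCoeff f k i j z = 1 / 4 *
      (schwarzian f z (EuclideanSpace.single i 1 + (1 : ℂ) • EuclideanSpace.single j 1) k
        - schwarzian f z (EuclideanSpace.single i 1 + (-1 : ℂ) • EuclideanSpace.single j 1) k) := by
    rw [schwarzian_single_add, schwarzian_single_add,
      schwarzianCoeff_symm (hf.1.1 z hzp) k j i]
    ring
  rw [e, norm_mul]
  have h1 := hb 1 (by simp)
  have h2 := hb (-1) (by simp)
  have h3 : ‖(1 / 4 : ℂ)‖ = 1 / 4 := by norm_num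
  rw [h3]
  linarith [norm_sub_le
    (schwarzian f z (EuclideanSpace.single i 1 + (1 : ℂ) • EuclideanSpace.single j 1) k)
    (schwarzian f z (EuclideanSpace.single i 1 + (-1 : ℂ) • EuclideanSpace.single j 1) k)]

/-- In `schwarzianZero_eq` the two derivatives cost `4 * (8 * α)` each by Cauchy's estimate, and
each of the `n` summands consists of two products of size at most `(8 * α) ^ 2`. -/
theorem norm_schwarzianZero_le (hn : 2 ≤ n) {f : Cn n → Cn n} {α : ℝ} (hα : 0 ≤ α)
    (hf : f ∈ family n α) {z : Cn n} (hz : ∀ i, ‖z i‖ ≤ 1 / 4) (i j : Fin n) :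
    ‖schwarzianZero f i j z‖ ≤ 64 * α + n * (128 * α ^ 2) := by
  have hz' : ∀ i, ‖z i‖ ≤ 1 / 2 := fun i => (hz i).trans (by norm_num)
  have hzp : z ∈ polydisk n := fun i => (hz i).trans_lt (by norm_num)
  have : Nontrivial (Fin n) := Fin.nontrivial_iff_two_le.2 hn
  obtain ⟨l, hl⟩ := exists_ne j
  have hS := fun k i j => norm_schwarzianCoeff_le hα hf hz' k i j
  have hdS : ∀ m k i j, ‖partialDeriv m (schwarzianCoeff f k i j) z‖ ≤ 4 * (8 * α) :=
    fun m k i j => norm_partialDeriv_le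
      (fun w hw => analyticAt_schwarzianCoeff (hf.1.1 w hw) (hf.1.2 w hw) k i j)
      (fun w hw => norm_schwarzianCoeff_le hα hf hw k i j) hz m
  have hmul : ∀ {a b : ℂ}, ‖a‖ ≤ 8 * α → ‖b‖ ≤ 8 * α → ‖a * b‖ ≤ 64 * α ^ 2 := by
    intro a b ha hb
    rw [norm_mul]
    nlinarith [mul_le_mul ha hb (norm_nonneg _) (by positivity)]
  rw [schwarzianZero_eq (hf.1.1 z hzp) (hf.1.2 z hzp) hl]
  refine (norm_add_le _ _).trans (add_le_add ((norm_sub_le _ _).trans ?_) ?_)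
  · linarith [hdS j l i l, hdS l l i j]
  · refine (norm_sum_le _ _).trans ?_
    refine (Finset.sum_le_sum (g := fun _ => 128 * α ^ 2) fun k _ => ?_).trans (by simp)
    refine (norm_sub_le _ _).trans ?_
    linarith [hmul (hS k i l) (hS l j k), hmul (hS k i j) (hS l l k)]

end Bergman

/-! ### A uniform ball covered by the normalized mappings -/

section Covering

variable {f : Cn n → Cn n} {z : Cn n}

theorem partialDeriv_apply (hf : DifferentiableAt ℂ f z) (i l : Fin n) :
    partialDeriv i (fun w => f w l) z = fderiv ℂ f z (EuclideanSpace.single i 1) l := by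
  have h : HasFDerivAt (fun w => f w l) _ z :=
    (EuclideanSpace.proj l : Cn n →L[ℂ] ℂ).hasFDerivAt.comp z hf.hasFDerivAt
  rw [partialDeriv, h.fderiv]
  rfl

theorem fderiv_apply_coord (hf : DifferentiableAt ℂ f z) (v : Cn n) (l : Fin n) :
    fderiv ℂ f z v l = ∑ i, v i * partialDeriv i (fun w => f w l) z := by
  have h : HasFDerivAt (fun w => f w l) _ z :=
    (EuclideanSpace.proj l : Cn n →L[ℂ] ℂ).hasFDerivAt.comp z hf.hasFDerivAt
  rw [← fderiv_apply_eq_sum, h.fderiv]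
  rfl

theorem jacobianMatrix_eq_one (hf : DifferentiableAt ℂ f z)
    (h : fderiv ℂ f z = ContinuousLinearMap.id ℂ (Cn n)) : jacobianMatrix f z = 1 := by
  ext l i
  rw [jacobianMatrix, Matrix.of_apply, partialDeriv_apply hf, h, Matrix.one_apply]
  simp

theorem jac_zero_of_mem_family {α : ℝ} (hf : f ∈ family n α) : jac f 0 = 1 := by
  rw [jac, jacobianMatrix_eq_one (hf.1.1 0 (zero_mem_polydisk n)).differentiableAt hf.2.2.1,
    Matrix.det_one]

theorem normalizingParam_apply {α : ℝ} (hf : f ∈ family n α) (i : Fin n) :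
    normalizingParam f i = logJacGrad f i 0 := by
  simp [normalizingParam, logJacGrad, gradJac, jac_zero_of_mem_family hf]

theorem norm_le_sum_coord (v : Cn n) : ‖v‖ ≤ ∑ i, ‖v i‖ := by
  conv_lhs => rw [eq_sum_single v]
  refine (norm_sum_le _ _).trans (Finset.sum_le_sum fun i _ => ?_)
  rw [norm_smul]
  simp

/-- Perturbation of the quotient rule: `(V, W)` and `(H, U)` are jets of denominator and numerator,
close to `(1, 0)` and `(0, d)`. -/
theorem norm_quotient_sub_le {V W H U d : ℂ} {ε : ℝ} (hε : ε ≤ 1 / 20) (hV : ‖V - 1‖ ≤ ε)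
    (hW : ‖W‖ ≤ ε) (hH : ‖H‖ ≤ ε) (hU : ‖U - d‖ ≤ ε) (hd : ‖d‖ ≤ 1) :
    V ≠ 0 ∧ ‖(U * V - H * W) / V ^ 2 - d‖ ≤ 5 * ε := by
  have hε0 : 0 ≤ ε := (norm_nonneg _).trans hW
  have h1 : 1 - ε ≤ ‖V‖ := by
    have := norm_sub_norm_le (1 : ℂ) (1 - V)
    rw [sub_sub_cancel, norm_one, norm_sub_rev] at this
    linarith
  have h2 : ‖V‖ ≤ 1 + ε := by
    have := norm_add_le (V - 1) 1
    rw [sub_add_cancel, norm_one] at this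
    linarith
  have hV0 : V ≠ 0 := norm_pos_iff.1 (by linarith)
  refine ⟨hV0, ?_⟩
  have e : (U * V - H * W) / V ^ 2 - d = (V * ((U - d) - d * (V - 1)) - H * W) / V ^ 2 := by
    field_simp
    ring
  have h3 : ‖(U - d) - d * (V - 1)‖ ≤ 2 * ε := by
    refine (norm_sub_le _ _).trans ?_
    rw [norm_mul]
    nlinarith [norm_nonneg (V - 1), norm_nonneg d]
  have h4 : ‖V * ((U - d) - d * (V - 1)) - H * W‖ ≤ (1 + ε) * (2 * ε) + ε * ε := by
    refine (norm_sub_le _ _).trans ?_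
    rw [norm_mul, norm_mul]
    exact add_le_add (mul_le_mul h2 h3 (norm_nonneg _) (by positivity))
      (mul_le_mul hH hW (norm_nonneg _) hε0)
  rw [e, norm_div, norm_pow, div_le_iff₀ (by positivity)]
  have h5 : (1 - ε) ^ 2 ≤ ‖V‖ ^ 2 := by gcongr; linarith
  nlinarith

/-- Quantitative inverse function theorem: `g` differs from the identity by a `1 / 2`-Lipschitz map,
which leaves the radius `(1 - 1 / 2) * r`. -/
theorem closedBall_subset_image_of_fderiv_near_id {g : Cn n → Cn n} {r : ℝ} (hr : 0 ≤ r)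
    (hg : ∀ w ∈ Metric.closedBall (0 : Cn n) r, DifferentiableAt ℂ g w ∧
      ‖fderiv ℂ g w - ContinuousLinearMap.id ℂ (Cn n)‖ ≤ 1 / 2) :
    Metric.closedBall (g 0) (r / 2) ⊆ g '' Metric.closedBall 0 r := by
  have h : ApproximatesLinearOn g (ContinuousLinearMap.id ℂ (Cn n))
      (Metric.closedBall (0 : Cn n) r) (1 / 2) := by
    intro x hx y hy
    have := (convex_closedBall (0 : Cn n) r).norm_image_sub_le_of_norm_hasFDerivWithin_le'
      (fun w hw => (hg w hw).1.hasFDerivAt.hasFDerivWithinAt) (fun w hw => (hg w hw).2) hy hx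
    simpa using this
  let R : (ContinuousLinearMap.id ℂ (Cn n)).NonlinearRightInverse :=
    { toFun := id, nnnorm := 1, bound' := by simp, right_inv' := by intro y; simp }
  have := h.surjOn_closedBall_of_nonlinearRightInverse R hr subset_rfl
  have e : (((R.nnnorm : ℝ))⁻¹ - ((1 / 2 : NNReal) : ℝ)) * r = r / 2 := by
    have : (R.nnnorm : ℝ) = 1 := rfl
    rw [this]
    push_cast
    ring
  rwa [e] at this

theorem isFlatFunction_moebiusDenom (hf : IsLocallyBiholomorphic f) (a : Cn n) :
    IsFlatFunction f (fun w => moebiusDenom a (f w)) :=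
  (isFlatFunction_const f 1).add
    (IsFlatFunction.sum _ fun i => (isFlatFunction_coord hf i).const_mul (a i))

/-- The parameter `a` is exactly the value that kills the gradient part of this jet at the origin.
-/
theorem jet_moebiusDenom_zero {α : ℝ} (hf : f ∈ family n α) :
    jet f 1 (fun w => moebiusDenom (normalizingParam f) (f w)) 0 = (1, 0) := by
  have han := hf.1.1 0 (zero_mem_polydisk n)
  have hM := jacobianMatrix_eq_one han.differentiableAt hf.2.2.1
  have hd : ∀ i, DifferentiableAt ℂ (fun w => f w i) 0 := fun i => (han.coord i).differentiableAt
  have e : moebiusDenom (normalizingParam f) (f 0) = 1 := by simp [moebiusDenom, hf.2.1]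
  simp only [jet, e]
  refine Prod.ext (by simp) (funext fun k => ?_)
  have e2 : partialDeriv k (fun w => moebiusDenom (normalizingParam f) (f w)) 0
      = logJacGrad f k 0 := by
    unfold moebiusDenom
    rw [partialDeriv_add (differentiableAt_const _)
        (DifferentiableAt.fun_sum fun i _ => (hd i).const_mul _), partialDeriv_const,
      partialDeriv_sum _ fun i _ => (hd i).const_mul _]
    simp_rw [partialDeriv_const_mul _ (hd _)]
    have e3 : ∀ i, partialDeriv k (fun w => f w i) 0 = if i = k then 1 else 0 := fun i =>
      congrFun (congrFun hM i) k
    simp [e3, normalizingParam_apply hf]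
  simp [e2]

theorem jet_coord_zero {α : ℝ} (hf : f ∈ family n α) (l : Fin n) :
    jet f 1 (fun w => f w l) 0 = (0, fun k => if l = k then 1 else 0) := by
  have han := hf.1.1 0 (zero_mem_polydisk n)
  have hM := jacobianMatrix_eq_one han.differentiableAt hf.2.2.1
  have e3 : ∀ k, partialDeriv k (fun w => f w l) 0 = if l = k then 1 else 0 := fun k =>
    congrFun (congrFun hM l) k
  simp [jet, hf.2.1, e3]

/-- The normalized mappings cover a common ball about the origin. -/
theorem exists_ball_subset_normalizedImage (hn : 2 ≤ n) {α : ℝ} (hα : 0 ≤ α) :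
    ∃ δ > 0, ∀ f ∈ family n α, Metric.ball 0 δ ⊆ normalizedImage f := by
  set C : ℝ := 8 * α + (64 * α + n * (128 * α ^ 2)) with hC
  have hC0 : 0 ≤ C := by positivity
  have hCS : 8 * α ≤ C := le_add_of_nonneg_right (by positivity)
  have hn1 : (2 : ℝ) ≤ n := by exact_mod_cast hn
  set D : ℝ := n * C + C + 1 with hD
  have hD1 : 1 ≤ D := by rw [hD]; nlinarith [mul_nonneg (show (0 : ℝ) ≤ n by linarith) hC0]
  -- Each entry of `Dg - I` will be at most `5 * ε`; over `n ^ 2` entries this adds up to `1 / 4`,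
  -- below the required `1 / 2`.
  set ε : ℝ := 1 / (20 * n ^ 2) with hε
  have hε0 : 0 < ε := by positivity
  have hε20 : ε ≤ 1 / 20 := by
    rw [hε]
    exact one_div_le_one_div_of_le (by norm_num) (by nlinarith)
  -- This makes the factor `2 * (n * r * D)` in the jet estimate equal to `ε`.
  set r : ℝ := ε / (2 * n * D) with hr
  have hr0 : 0 < r := by positivity
  have hrK : n * r * D = ε / 2 := by rw [hr]; field_simp
  have hr4 : r ≤ 1 / 4 := by
    have h1 : 1 ≤ (n : ℝ) * D := by nlinarith
    have : r * 1 ≤ r * (n * D) := mul_le_mul_of_nonneg_left h1 hr0.le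
    linarith
  refine ⟨r / 2, by positivity, fun f hf => ?_⟩
  set a := normalizingParam f with ha
  have hball : ∀ ζ ∈ Metric.closedBall (0 : Cn n) r, ∀ i, ‖ζ i‖ ≤ r := fun ζ hζ i =>
    (PiLp.norm_apply_le ζ i).trans (by simpa using hζ)
  have hpoly : ∀ ζ ∈ Metric.closedBall (0 : Cn n) r, ζ ∈ polydisk n := fun ζ hζ i =>
    (hball ζ hζ i).trans_lt (by linarith)
  have key : ∀ ζ ∈ Metric.closedBall (0 : Cn n) r, moebiusDenom a (f ζ) ≠ 0 ∧
      ∀ l k, ‖(partialDeriv k (fun w => f w l) ζ * moebiusDenom a (f ζ)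
        - f ζ l * partialDeriv k (fun w => moebiusDenom a (f w)) ζ) / moebiusDenom a (f ζ) ^ 2
        - (if l = k then 1 else 0)‖ ≤ 5 * ε := by
    intro ζ hζ
    obtain ⟨c, hc, hjet⟩ := exists_norm_jet_sub_le hf.1 hC0
      (fun w hw k i j => (norm_schwarzianCoeff_le hα hf
        (fun i => (hw i).trans (by norm_num)) k i j).trans hCS)
      (fun w hw i j => (norm_schwarzianZero_le hn hα hf hw i j).trans (by rw [hC]; linarith))
      hr4 hr0.le (by rw [← hD, hrK]; linarith) (hball ζ hζ)
    rw [← hD, hrK] at hjet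
    have hden := hjet _ (isFlatFunction_moebiusDenom hf.1 a)
    rw [jet_moebiusDenom_zero hf] at hden
    have hone : ‖((1 : ℂ), (0 : Fin n → ℂ))‖ ≤ 1 := by simp [Prod.norm_def]
    replace hden := (hden.trans (mul_le_of_le_one_right (by positivity) hone)).trans
      (le_of_eq (mul_div_cancel₀ ε two_ne_zero))
    obtain ⟨hV, hW⟩ := norm_prod_le_iff.1 hden
    have hco : ∀ l, ‖jet f c (fun w => f w l) ζ
        - ((0 : ℂ), fun k : Fin n => if l = k then (1 : ℂ) else 0)‖ ≤ ε := by
      intro l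
      have h := hjet _ (isFlatFunction_coord hf.1 l)
      rw [jet_coord_zero hf l] at h
      have hone : ‖((0 : ℂ), fun k : Fin n => if l = k then (1 : ℂ) else 0)‖ ≤ 1 := by
        refine norm_prod_le_iff.2 ⟨by simp, (pi_norm_le_iff_of_nonneg zero_le_one).2 fun k => ?_⟩
        dsimp only
        split_ifs <;> simp
      exact (h.trans (mul_le_of_le_one_right (by positivity) hone)).trans
        (le_of_eq (mul_div_cancel₀ ε two_ne_zero))
    -- In `U * V - H * W` the `logJacGrad` terms cancel, and the factor `c ^ 2` cancels against the
    -- denominator, leaving the derivative of `f_l / (1 + a · f)`.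
    have main : ∀ l k, c * moebiusDenom a (f ζ) ≠ 0 ∧ _ := fun l k =>
      norm_quotient_sub_le hε20 hV
        (W := c * (partialDeriv k (fun w => moebiusDenom a (f w)) ζ
          - logJacGrad f k ζ * moebiusDenom a (f ζ)))
        (by simpa [jet] using (norm_le_pi_norm _ k).trans hW)
        (H := c * f ζ l) (by simpa [jet] using (norm_prod_le_iff.1 (hco l)).1)
        (U := c * (partialDeriv k (fun w => f w l) ζ - logJacGrad f k ζ * f ζ l))
        (d := if l = k then 1 else 0)
        (by simpa [jet] using (norm_le_pi_norm _ k).trans (norm_prod_le_iff.1 (hco l)).2)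
        (by split_ifs <;> simp)
    have hne : moebiusDenom a (f ζ) ≠ 0 :=
      right_ne_zero_of_mul (main ⟨0, by omega⟩ ⟨0, by omega⟩).1
    refine ⟨hne, fun l k => ?_⟩
    convert (main l k).2 using 3
    simp only
    field_simp
    ring
  set g : Cn n → Cn n := fun w => moebius a (f w) with hg
  have hgd : ∀ ζ ∈ Metric.closedBall (0 : Cn n) r, DifferentiableAt ℂ g ζ := fun ζ hζ =>
    DifferentiableAt.smul ((isFlatFunction_moebiusDenom hf.1 a ζ
      (hpoly ζ hζ)).1.differentiableAt.inv (key ζ hζ).1)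
      (hf.1.1 ζ (hpoly ζ hζ)).differentiableAt
  have hcov := closedBall_subset_image_of_fderiv_near_id (g := g) hr0.le fun ζ hζ => by
    refine ⟨hgd ζ hζ, ContinuousLinearMap.opNorm_le_bound _ (by norm_num) fun v => ?_⟩
    refine (norm_le_sum_coord _).trans ?_
    have hl : ∀ l, ‖(fderiv ℂ g ζ - ContinuousLinearMap.id ℂ (Cn n)) v l‖
        ≤ n * (5 * ε * ‖v‖) := by
      intro l
      have e : (fderiv ℂ g ζ - ContinuousLinearMap.id ℂ (Cn n)) v l
          = ∑ k, v k * (partialDeriv k (fun w => g w l) ζ - if l = k then 1 else 0) := by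
        simp only [mul_sub, Finset.sum_sub_distrib, ← fderiv_apply_coord (hgd ζ hζ)]
        simp
      rw [e]
      refine (norm_sum_le _ _).trans ?_
      refine (Finset.sum_le_sum (g := fun _ => 5 * ε * ‖v‖) fun k _ => ?_).trans (by simp)
      have e2 : (fun w => g w l) = fun w => f w l / moebiusDenom a (f w) := by
        funext w
        simp only [hg, moebius, PiLp.smul_apply, smul_eq_mul, div_eq_inv_mul]
      rw [norm_mul, mul_comm, e2, partialDeriv_div
        ((hf.1.1 ζ (hpoly ζ hζ)).coord l).differentiableAt
        (isFlatFunction_moebiusDenom hf.1 a ζ (hpoly ζ hζ)).1.differentiableAt (key ζ hζ).1]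
      exact mul_le_mul ((key ζ hζ).2 l k) (PiLp.norm_apply_le v k) (norm_nonneg _) (by positivity)
    refine (Finset.sum_le_sum fun l _ => hl l).trans (le_of_eq_of_le (b := 1 / 4 * ‖v‖) ?_ ?_)
    · simp only [Finset.sum_const, Finset.card_univ, Fintype.card_fin, nsmul_eq_mul, hε]
      field_simp
      ring
    · gcongr
      norm_num
  have hg0 : g 0 = 0 := by simp [hg, moebius, hf.2.1]
  rw [hg0] at hcov
  intro w hw
  obtain ⟨ζ, hζ, rfl⟩ := hcov (Metric.ball_subset_closedBall hw)
  exact ⟨ζ, hpoly ζ hζ, (key ζ hζ).1, rfl⟩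

end Covering

/-! ### Covering radius and order at the origin -/

theorem schwarzianCoeff_id (k i j : Fin n) (z : Cn n) :
    schwarzianCoeff (id : Cn n → Cn n) k i j z = 0 := by
  have h1 : ∀ (j l : Fin n), partialDeriv j (fun x : Cn n => x l)
      = fun _ => if l = j then 1 else 0 := fun j l => funext fun w => partialDeriv_coord l
  have h2 : jac (id : Cn n → Cn n) = fun _ => 1 := by
    funext w
    rw [jac, jacobianMatrix_eq_one differentiableAt_id fderiv_id, Matrix.det_one]
  simp [schwarzianCoeff, h1, h2, partialDeriv_const]

theorem id_mem_family {α : ℝ} (hα : 0 ≤ α) : (id : Cn n → Cn n) ∈ family n α := by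
  refine ⟨⟨analyticOnNhd_id, fun z _ => ?_⟩, rfl, fderiv_id,
    (schwarzianNorm_le_iff hα).2 fun z _ v _ => ?_⟩
  · rw [jac, jacobianMatrix_eq_one differentiableAt_id fderiv_id, Matrix.det_one]
    exact one_ne_zero
  · have : schwarzian (id : Cn n → Cn n) z v = (0 : ℂ) • v := by
      ext k
      simp [schwarzian, schwarzianCoeff_id]
    rw [this, bergmanNorm_smul]
    simpa using hα

theorem normalizedImage_id_subset : normalizedImage (id : Cn n → Cn n) ⊆ polydisk n := by
  have h2 : jac (id : Cn n → Cn n) = fun _ => 1 := by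
    funext w
    rw [jac, jacobianMatrix_eq_one differentiableAt_id fderiv_id, Matrix.det_one]
  have ha : ∀ i, normalizingParam (id : Cn n → Cn n) i = 0 := by
    intro i
    simp [normalizingParam, gradJac, h2, partialDeriv_const]
  rintro w ⟨z, hz, _, rfl⟩
  simpa [moebius, moebiusDenom, ha] using hz

/-- The radii occurring in the definition of the covering radius. -/
def coveringSet (n : ℕ) (α : ℝ) : Set ℝ :=
  {s : ℝ | ∀ f ∈ family n α, Metric.ball 0 s ⊆ normalizedImage f}

/-- The identity belongs to every family and, being already normalized, misses the first unit
vector. Boundedness is needed because the real `sSup` of an unbounded set is `0`. -/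
theorem bddAbove_coveringSet (hn : 0 < n) {α : ℝ} (hα : 0 ≤ α) : BddAbove (coveringSet n α) := by
  refine ⟨1, fun s hs => ?_⟩
  by_contra! h
  have := normalizedImage_id_subset (hs id (id_mem_family hα)
    (show EuclideanSpace.single (⟨0, hn⟩ : Fin n) (1 : ℂ) ∈ Metric.ball 0 s by simpa using h))
    ⟨0, hn⟩
  simp at this

theorem coveringRadius_pos (hn : 2 ≤ n) {α : ℝ} (hα : 0 ≤ α) : 0 < coveringRadius n α := by
  obtain ⟨δ, hδ, h⟩ := exists_ball_subset_normalizedImage hn hα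
  exact hδ.trans_le (le_csSup (bddAbove_coveringSet (by omega) hα) h)

/-- The supremum is attained because the balls are open. -/
theorem ball_coveringRadius_subset {α : ℝ} {f : Cn n → Cn n} (hf : f ∈ family n α) :
    Metric.ball 0 (coveringRadius n α) ⊆ normalizedImage f := by
  intro w hw
  have hne : (coveringSet n α).Nonempty := ⟨0, fun g _ => by simp⟩
  obtain ⟨s, hs, hws⟩ := exists_lt_of_lt_csSup hne (mem_ball_zero_iff.1 hw)
  exact hs f hf (mem_ball_zero_iff.2 hws)

/-- The vector whose coordinates are the conjugates of those of `a`. -/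
def conjVec (a : Cn n) : Cn n := WithLp.toLp 2 fun i => star (a i)

theorem norm_conjVec (a : Cn n) : ‖conjVec a‖ = ‖a‖ := by
  simp [conjVec, EuclideanSpace.norm_eq]

theorem norm_sum_mul_le (a y : Cn n) : ‖∑ i, a i * y i‖ ≤ ‖a‖ * ‖y‖ := by
  have h := norm_inner_le_norm (𝕜 := ℂ) (conjVec a) y
  rw [norm_conjVec] at h
  refine le_trans (le_of_eq ?_) h
  congr 1
  rw [PiLp.inner_apply]
  refine Finset.sum_congr rfl fun i _ => ?_
  simp [conjVec, mul_comm]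

/-- Two consequences are used: finite values of `T_a` avoid the hyperplane `∑ a_i y_i = 1`, and the
image point determines the denominator, whence injectivity. -/
theorem sum_mul_moebius {a w : Cn n} (h : moebiusDenom a w ≠ 0) :
    ∑ i, a i * moebius a w i = 1 - (moebiusDenom a w)⁻¹ := by
  have e : ∑ i, a i * w i = moebiusDenom a w - 1 := by simp [moebiusDenom]
  calc ∑ i, a i * moebius a w i = (moebiusDenom a w)⁻¹ * ∑ i, a i * w i := by
        rw [Finset.mul_sum]
        refine Finset.sum_congr rfl fun i _ => ?_
        simp only [moebius, PiLp.smul_apply, smul_eq_mul]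
        ring
    _ = _ := by
        rw [e]
        field_simp

theorem moebius_injOn (a : Cn n) : Set.InjOn (moebius a) {w | moebiusDenom a w ≠ 0} := by
  intro w hw y hy e
  have h1 := sum_mul_moebius hw
  rw [e, sum_mul_moebius hy] at h1
  have h2 : moebiusDenom a y = moebiusDenom a w := inv_injective (by linear_combination -h1)
  unfold moebius at e
  rw [h2] at e
  exact smul_right_injective _ (inv_ne_zero hw) e

/-- The point of the omitted hyperplane `∑ a_i y_i = 1` nearest to the origin is the conjugate of
`a` divided by `|a| ^ 2`, of norm `1 / |a|`; a covered ball cannot contain it. -/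
theorem norm_normalizingParam_mul_le {s : ℝ} {f : Cn n → Cn n}
    (hs : Metric.ball 0 s ⊆ normalizedImage f) : ‖normalizingParam f‖ * s ≤ 1 := by
  set a := normalizingParam f with ha
  by_contra! h
  have ha0 : a ≠ 0 := by
    rintro h0
    rw [h0] at h
    simp at h
    linarith
  have hpos : 0 < ‖a‖ := norm_pos_iff.2 ha0
  set y : Cn n := (((‖a‖ ^ 2)⁻¹ : ℝ) : ℂ) • conjVec a with hy
  have hyn : ‖y‖ < s := by
    rw [hy, norm_smul, norm_conjVec, Complex.norm_real, Real.norm_eq_abs,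
      abs_of_pos (by positivity)]
    have : (‖a‖ ^ 2)⁻¹ * ‖a‖ = ‖a‖⁻¹ := by field_simp
    rw [this, inv_lt_iff_one_lt_mul₀ hpos]
    rwa [mul_comm]
  obtain ⟨z, -, hd, hm⟩ := hs (mem_ball_zero_iff.2 hyn)
  have h1 := sum_mul_moebius hd
  rw [hm] at h1
  have h2 : ∑ i, a i * y i = 1 := by
    have e : ∀ i, a i * y i = (((‖a‖ ^ 2)⁻¹ : ℝ) : ℂ) * ((‖a i‖ ^ 2 : ℝ) : ℂ) := by
      intro i
      simp only [hy, conjVec, PiLp.smul_apply, smul_eq_mul]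
      rw [mul_left_comm]
      congr 1
      push_cast
      exact Complex.mul_conj' (a i)
    simp only [e]
    rw [← Finset.mul_sum, ← Complex.ofReal_sum, ← EuclideanSpace.norm_sq_eq, ← Complex.ofReal_mul,
      inv_mul_cancel₀ (by positivity), Complex.ofReal_one]
  rw [h2] at h1
  exact inv_ne_zero hd (by linear_combination h1)

theorem gradJac_eq_smul_normalizingParam (f : Cn n → Cn n) :
    gradJac f 0 = ((n : ℂ) + 1) • normalizingParam f := by
  rw [normalizingParam, smul_smul, mul_one_div_cancel (by exact_mod_cast n.succ_ne_zero), one_smul]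

/-- Since `∇J_f(0) = (n + 1) a` and `|a| s₀ ≤ 1`, the order is at most `(n + 1) / s₀`. -/
theorem bddAbove_orderSet (hn : 2 ≤ n) {α : ℝ} (hα : 0 ≤ α) : BddAbove (orderSet n α) := by
  have hpos := coveringRadius_pos hn hα
  refine ⟨((n : ℝ) + 1) * (coveringRadius n α)⁻¹, ?_⟩
  rintro _ ⟨f, hf, rfl⟩
  have h := norm_normalizingParam_mul_le (ball_coveringRadius_subset hf)
  have hc : ‖(n : ℂ) + 1‖ = n + 1 := by exact_mod_cast Complex.norm_natCast (n + 1)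
  simp only
  rw [gradJac_eq_smul_normalizingParam, norm_smul, hc]
  gcongr
  rwa [← one_div, le_div_iff₀ hpos]

/-- For `|y| < s₀ / 2` one has `|a · y| ≤ 1 / 2`, so `|T_a y| ≤ 2 |y| < s₀`. Thus `T_a y` is a value
of `T_a ∘ f`, and injectivity of `T_a` makes `y` a value of `f`. -/
theorem ball_half_coveringRadius_subset {α : ℝ} {f : Cn n → Cn n} (hf : f ∈ family n α) :
    Metric.ball 0 (coveringRadius n α / 2) ⊆ f '' polydisk n := by
  intro y hy
  rw [mem_ball_zero_iff] at hy
  set a := normalizingParam f with ha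
  have h := norm_normalizingParam_mul_le (ball_coveringRadius_subset hf)
  have h1 : ‖∑ i, a i * y i‖ ≤ 1 / 2 := by
    refine (norm_sum_mul_le a y).trans ?_
    nlinarith [norm_nonneg a]
  have h2 : 1 / 2 ≤ ‖moebiusDenom a y‖ := by
    have h3 := norm_sub_norm_le (1 : ℂ) (-∑ i, a i * y i)
    rw [sub_neg_eq_add, norm_neg, norm_one] at h3
    unfold moebiusDenom
    linarith
  have h0 : moebiusDenom a y ≠ 0 := norm_pos_iff.1 (by linarith)
  have h3 : moebius a y ∈ Metric.ball 0 (coveringRadius n α) := by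
    rw [mem_ball_zero_iff, moebius, norm_smul, norm_inv, inv_mul_lt_iff₀ (by linarith)]
    have : 0 < coveringRadius n α := by linarith [norm_nonneg y]
    nlinarith
  obtain ⟨ζ, hζ, hd, hm⟩ := ball_coveringRadius_subset hf h3
  exact ⟨ζ, hζ, moebius_injOn a hd h0 hm⟩

/-! ### Disk automorphisms -/

section DiskAutomorphism

variable {a w : ℂ}

/-- The automorphism of the unit disk that sends `0` to `a`. -/
def diskAut (a w : ℂ) : ℂ := (w + a) / (1 + star a * w)

/-- The derivative of `diskAut a`. -/
def diskAutDeriv (a w : ℂ) : ℂ := ((1 - ‖a‖ ^ 2 : ℝ) : ℂ) / (1 + star a * w) ^ 2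

/-- The logarithmic derivative of `diskAutDeriv a`. -/
def diskAutLogDeriv (a w : ℂ) : ℂ := -2 * star a / (1 + star a * w)

theorem one_sub_mul_le_norm_denom (a w : ℂ) : 1 - ‖a‖ * ‖w‖ ≤ ‖1 + star a * w‖ := by
  have h := norm_sub_norm_le (1 : ℂ) (-(star a * w))
  rw [sub_neg_eq_add, norm_neg, norm_one, norm_mul, norm_star] at h
  exact h

theorem diskAut_denom_ne_zero (ha : ‖a‖ < 1) (hw : ‖w‖ < 1) : 1 + star a * w ≠ 0 := by
  have h := one_sub_mul_le_norm_denom a w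
  exact norm_pos_iff.1 (by nlinarith [norm_nonneg a, norm_nonneg w])

theorem star_mul_self_eq (a : ℂ) : star a * a = ((‖a‖ ^ 2 : ℝ) : ℂ) := by
  push_cast
  exact Complex.conj_mul' a

theorem hasDerivAt_diskAut (h : 1 + star a * w ≠ 0) :
    HasDerivAt (diskAut a) (diskAutDeriv a w) w := by
  have h1 : HasDerivAt (fun w => w + a) 1 w := (hasDerivAt_id w).add_const a
  have h2 : HasDerivAt (fun w => 1 + star a * w) (star a * 1) w :=
    ((hasDerivAt_id w).const_mul (star a)).const_add 1
  refine (h1.fun_div h2 h).congr_deriv ?_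
  rw [diskAutDeriv, Complex.ofReal_sub, ← star_mul_self_eq, Complex.ofReal_one]
  congr 1
  ring

theorem hasDerivAt_diskAutDeriv (h : 1 + star a * w ≠ 0) :
    HasDerivAt (diskAutDeriv a) (diskAutDeriv a w * diskAutLogDeriv a w) w := by
  have h2 : HasDerivAt (fun w => 1 + star a * w) (star a * 1) w :=
    ((hasDerivAt_id w).const_mul (star a)).const_add 1
  refine ((hasDerivAt_const w ((1 - ‖a‖ ^ 2 : ℝ) : ℂ)).fun_div (h2.fun_pow 2)
    (pow_ne_zero 2 h)).congr_deriv ?_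
  rw [diskAutDeriv, diskAutLogDeriv]
  field_simp
  push_cast
  ring

theorem diskAutDeriv_ne_zero (ha : ‖a‖ < 1) (hw : ‖w‖ < 1) : diskAutDeriv a w ≠ 0 := by
  refine div_ne_zero (Complex.ofReal_ne_zero.2 ?_) (pow_ne_zero 2 (diskAut_denom_ne_zero ha hw))
  nlinarith [norm_nonneg a]

/-- Equality in the Schwarz–Pick lemma; it makes polydisk automorphisms Bergman isometries. -/
theorem one_sub_norm_diskAut_sq (ha : ‖a‖ < 1) (hw : ‖w‖ < 1) :
    1 - ‖diskAut a w‖ ^ 2 = ‖diskAutDeriv a w‖ * (1 - ‖w‖ ^ 2) := by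
  have h0 := diskAut_denom_ne_zero ha hw
  have hpos : 0 < ‖1 + star a * w‖ ^ 2 := by positivity
  have e : ‖1 + star a * w‖ ^ 2 - ‖w + a‖ ^ 2 = (1 - ‖a‖ ^ 2) * (1 - ‖w‖ ^ 2) := by
    apply Complex.ofReal_injective
    push_cast
    simp only [← Complex.conj_mul', map_add, map_mul, map_one, Complex.star_def, Complex.conj_conj]
    ring
  rw [diskAut, diskAutDeriv, norm_div, norm_div, div_pow, norm_pow, Complex.norm_real,
    Real.norm_eq_abs, abs_of_nonneg (by nlinarith [norm_nonneg a])]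
  rw [one_sub_div hpos.ne', e, div_mul_eq_mul_div]

theorem norm_diskAut_lt_one (ha : ‖a‖ < 1) (hw : ‖w‖ < 1) : ‖diskAut a w‖ < 1 := by
  have h := one_sub_norm_diskAut_sq ha hw
  have h1 : 0 < ‖diskAutDeriv a w‖ * (1 - ‖w‖ ^ 2) :=
    mul_pos (norm_pos_iff.2 (diskAutDeriv_ne_zero ha hw)) (by nlinarith [norm_nonneg w])
  nlinarith [norm_nonneg (diskAut a w)]

/-- The denominator is at least `1 - ‖w‖`, while `1 - ‖w‖ ^ 2 ≤ 2 * (1 - ‖w‖)`. -/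
theorem norm_diskAutLogDeriv_mul_le (ha : ‖a‖ < 1) (hw : ‖w‖ < 1) :
    ‖diskAutLogDeriv a w‖ * (1 - ‖w‖ ^ 2) ≤ 4 * ‖a‖ := by
  have h := one_sub_mul_le_norm_denom a w
  have hpos : 0 < ‖1 + star a * w‖ := norm_pos_iff.2 (diskAut_denom_ne_zero ha hw)
  have ha0 := norm_nonneg a
  have hw0 := norm_nonneg w
  have h1 : 1 - ‖w‖ ≤ ‖1 + star a * w‖ := by nlinarith
  have h2 : ‖(-2 : ℂ)‖ = 2 := by simp
  rw [diskAutLogDeriv, norm_div, norm_mul, norm_star, h2, div_mul_eq_mul_div, div_le_iff₀ hpos]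
  have h3 : 1 - ‖w‖ ^ 2 ≤ 2 * ‖1 + star a * w‖ := by nlinarith
  nlinarith

end DiskAutomorphism

/-! ### Polydisk automorphisms and the size of their Schwarzian -/

section PolydiskAutomorphism

variable {z w : Cn n}

/-- The automorphism of the polydisk that sends `0` to `z`. -/
def polydiskAut (z w : Cn n) : Cn n := WithLp.toLp 2 fun i => diskAut (z i) (w i)

theorem polydiskAut_mem (hz : z ∈ polydisk n) (hw : w ∈ polydisk n) :
    polydiskAut z w ∈ polydisk n := fun i => norm_diskAut_lt_one (hz i) (hw i)

theorem polydiskAut_zero (z : Cn n) : polydiskAut z 0 = z := by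
  ext i
  simp [polydiskAut, diskAut]

theorem analyticAt_toLp {F : Cn n → Fin n → ℂ} (hF : ∀ i, AnalyticAt ℂ (fun w => F w i) w) :
    AnalyticAt ℂ (fun w => (WithLp.toLp 2 (F w) : Cn n)) w :=
  ((EuclideanSpace.equiv (Fin n) ℂ).symm.toContinuousLinearMap.analyticAt _).comp
    (analyticAt_pi_iff.2 hF)

theorem analyticAt_polydiskAut (hz : z ∈ polydisk n) (hw : w ∈ polydisk n) :
    AnalyticAt ℂ (polydiskAut z) w :=
  analyticAt_toLp fun i => ((analyticAt_coord i w).add analyticAt_const).div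
    (analyticAt_const.add (analyticAt_const.mul (analyticAt_coord i w)))
    (diskAut_denom_ne_zero (hz i) (hw i))

theorem hasFDerivAt_comp_coord {φ : ℂ → ℂ} {φ' : ℂ} {l : Fin n} (h : HasDerivAt φ φ' (w l)) :
    HasFDerivAt (fun w : Cn n => φ (w l)) (φ' • (EuclideanSpace.proj l : Cn n →L[ℂ] ℂ)) w :=
  h.comp_hasFDerivAt w (EuclideanSpace.proj l : Cn n →L[ℂ] ℂ).hasFDerivAt

theorem partialDeriv_comp_coord {φ : ℂ → ℂ} {φ' : ℂ} {l : Fin n} (h : HasDerivAt φ φ' (w l))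
    (i : Fin n) : partialDeriv i (fun w : Cn n => φ (w l)) w = if l = i then φ' else 0 := by
  rw [partialDeriv, (hasFDerivAt_comp_coord h).fderiv]
  simp

theorem partialDeriv_comp_polydiskAut {h : Cn n → ℂ} (hz : z ∈ polydisk n) (hw : w ∈ polydisk n)
    (hh : DifferentiableAt ℂ h (polydiskAut z w)) (j : Fin n) :
    partialDeriv j (fun w => h (polydiskAut z w)) w
      = partialDeriv j h (polydiskAut z w) * diskAutDeriv (z j) (w j) := by
  have ha := (analyticAt_polydiskAut hz hw).differentiableAt
  have e : fderiv ℂ (polydiskAut z) w (EuclideanSpace.single j 1)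
      = diskAutDeriv (z j) (w j) • EuclideanSpace.single j 1 := by
    ext l
    rw [← partialDeriv_apply ha]
    refine (partialDeriv_comp_coord
      (hasDerivAt_diskAut (diskAut_denom_ne_zero (hz l) (hw l))) j).trans ?_
    by_cases hlj : l = j
    · subst hlj
      simp
    · simp [hlj]
  have h1 : HasFDerivAt (fun w => h (polydiskAut z w)) _ w :=
    hh.hasFDerivAt.comp w ha.hasFDerivAt
  rw [partialDeriv, h1.fderiv, ContinuousLinearMap.comp_apply, e, map_smul, smul_eq_mul, mul_comm]
  rfl

theorem partialDeriv_diskAutDeriv (hz : z ∈ polydisk n) (hw : w ∈ polydisk n) (i j : Fin n) :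
    partialDeriv i (fun w : Cn n => diskAutDeriv (z j) (w j)) w
      = if j = i then diskAutDeriv (z j) (w j) * diskAutLogDeriv (z j) (w j) else 0 :=
  partialDeriv_comp_coord (hasDerivAt_diskAutDeriv (diskAut_denom_ne_zero (hz j) (hw j))) i

theorem differentiableAt_diskAutDeriv (hz : z ∈ polydisk n) (hw : w ∈ polydisk n) (j : Fin n) :
    DifferentiableAt ℂ (fun w : Cn n => diskAutDeriv (z j) (w j)) w :=
  (hasFDerivAt_comp_coord
    (hasDerivAt_diskAutDeriv (diskAut_denom_ne_zero (hz j) (hw j)))).differentiableAt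

theorem partialDeriv_prod_diskAutDeriv (hz : z ∈ polydisk n) (hw : w ∈ polydisk n) (i : Fin n) :
    partialDeriv i (fun w : Cn n => ∏ j, diskAutDeriv (z j) (w j)) w
      = (∏ j, diskAutDeriv (z j) (w j)) * diskAutLogDeriv (z i) (w i) := by
  have h := HasFDerivAt.finsetProd (u := Finset.univ) fun j _ =>
    (differentiableAt_diskAutDeriv hz hw j).hasFDerivAt
  rw [partialDeriv, h.fderiv, sum_apply]
  have e : ∀ j, fderiv ℂ (fun w : Cn n => diskAutDeriv (z j) (w j)) w (EuclideanSpace.single i 1)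
      = _ := fun j => partialDeriv_diskAutDeriv hz hw i j
  simp only [smul_apply, e, smul_eq_mul, mul_ite, mul_zero,
    Finset.sum_ite_eq', Finset.mem_univ, if_true]
  rw [← Finset.prod_erase_mul _ _ (Finset.mem_univ i)]
  ring

theorem bergmanNorm_polydiskAut (hz : z ∈ polydisk n) (hw : w ∈ polydisk n) {v u : Cn n}
    (hu : ∀ i, u i = diskAutDeriv (z i) (w i) * v i) :
    bergmanNorm (polydiskAut z w) u = bergmanNorm w v := by
  unfold bergmanNorm
  congr 2
  refine Finset.sum_congr rfl fun i _ => ?_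
  have h1 : 1 - ‖polydiskAut z w i‖ ^ 2 = _ := one_sub_norm_diskAut_sq (hz i) (hw i)
  have h2 : ‖diskAutDeriv (z i) (w i)‖ ≠ 0 := norm_ne_zero_iff.2 (diskAutDeriv_ne_zero (hz i) (hw i))
  have h3 := (one_sub_sq_pos hw i).ne'
  rw [hu, h1, norm_mul]
  field_simp

/-- The Schwarzian derivative of `polydiskAut z`. -/
def autSchwarzian (z w v : Cn n) : Cn n := WithLp.toLp 2 fun k =>
  diskAutLogDeriv (z k) (w k) * v k ^ 2
    - 2 / ((n : ℂ) + 1) * v k * ∑ j, diskAutLogDeriv (z j) (w j) * v j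

/-- Cauchy–Schwarz against the vector `e_k - c (1, …, 1)`, whose squared norm `1 - 2c + nc²` is at
most `1` exactly because `n * c ≤ 2`. This keeps the bound free of the dimension. -/
theorem norm_sub_mean_le {u q : Fin n → ℂ} {Q c : ℝ} (hu : ∑ j, ‖u j‖ ^ 2 = 1)
    (hq : ∀ j, ‖q j‖ ≤ Q) (hQ : 0 ≤ Q) (hc : 0 ≤ c) (hnc : n * c ≤ 2) (k : Fin n) :
    ‖q k * u k - c * ∑ j, q j * u j‖ ≤ Q := by
  set e : Fin n → ℝ := fun j => (if j = k then 1 else 0) - c with he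
  set x : Cn n := WithLp.toLp 2 fun j => (e j : ℂ) * q j with hx
  set y : Cn n := WithLp.toLp 2 u with hy
  have h1 : q k * u k - c * ∑ j, q j * u j = ∑ j, x j * y j := by
    simp only [hx, hy, he]
    push_cast
    simp only [apply_ite (Complex.ofReal), Complex.ofReal_one, Complex.ofReal_zero, sub_mul,
      ite_mul, one_mul, zero_mul, Finset.sum_sub_distrib, Finset.sum_ite_eq', Finset.mem_univ,
      if_true, Finset.mul_sum, mul_assoc]
  have h2 : ‖y‖ = 1 := by
    rw [EuclideanSpace.norm_eq]
    simpa [hy] using hu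
  have h3 : ∑ j, e j ^ 2 ≤ 1 := by
    have : ∀ j, e j ^ 2 = (if j = k then 1 - 2 * c else 0) + c ^ 2 := by
      intro j
      simp only [he]
      split_ifs <;> ring
    simp only [this, Finset.sum_add_distrib, Finset.sum_ite_eq', Finset.mem_univ, if_true,
      Finset.sum_const, Finset.card_univ, Fintype.card_fin, nsmul_eq_mul]
    nlinarith
  have h4 : ‖x‖ ≤ Q := by
    refine abs_le_of_sq_le_sq' ?_ hQ |>.2
    rw [EuclideanSpace.norm_sq_eq]
    calc ∑ j, ‖x j‖ ^ 2 ≤ ∑ j, e j ^ 2 * Q ^ 2 := by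
          refine Finset.sum_le_sum fun j _ => ?_
          simp only [hx, norm_mul, Complex.norm_real, Real.norm_eq_abs, mul_pow, sq_abs]
          gcongr
          exact hq j
      _ = (∑ j, e j ^ 2) * Q ^ 2 := by rw [Finset.sum_mul]
      _ ≤ Q ^ 2 := mul_le_of_le_one_left (by positivity) h3
  rw [h1]
  refine (norm_sum_mul_le x y).trans ?_
  rwa [h2, mul_one]

/-- In rescaled coordinates `v` becomes a unit vector `u`, and the `k`-th component is `u k` times
an expression bounded by `norm_sub_mean_le` with `c = 2 / (n + 1)`. The constant is `4 / √2 = 2√2`,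
from the logarithmic derivative and the Bergman weight. -/
theorem bergmanNorm_autSchwarzian_le (hz : z ∈ polydisk n) (hw : w ∈ polydisk n) {v : Cn n}
    (hv : bergmanNorm w v = 1) :
    bergmanNorm w (autSchwarzian z w v) ≤ 2 * Real.sqrt 2 * supNorm z := by
  set u := bergmanScale w v with hu
  set ρ : Fin n → ℝ := fun k => Real.sqrt 2 / (1 - ‖w k‖ ^ 2) with hρ
  set p : Fin n → ℂ := fun k => diskAutLogDeriv (z k) (w k) with hp
  set Q : ℝ := 2 * Real.sqrt 2 * supNorm z with hQ
  have hs := supNorm_nonneg z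
  have hQ0 : 0 ≤ Q := by positivity
  have h2 : Real.sqrt 2 * Real.sqrt 2 = 2 := Real.mul_self_sqrt (by norm_num)
  have hρ0 : ∀ k, 0 < ρ k := fun k => div_pos (by positivity) (one_sub_sq_pos hw k)
  have hρne : ∀ k, (ρ k : ℂ) ≠ 0 := fun k => Complex.ofReal_ne_zero.2 (hρ0 k).ne'
  have hus : ∑ j, ‖u j‖ ^ 2 = 1 := by
    rw [← EuclideanSpace.norm_sq_eq, hu, ← bergmanNorm_eq, hv, one_pow]
  have huk : ∀ k, u k = ρ k * v k := fun k => rfl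
  have hq : ∀ j, ‖p j / ρ j‖ ≤ Q := by
    intro j
    rw [norm_div, Complex.norm_real, Real.norm_eq_abs, abs_of_pos (hρ0 j), div_le_iff₀ (hρ0 j)]
    have h3 := norm_diskAutLogDeriv_mul_le (hz j) (hw j)
    have h4 := norm_coord_le_supNorm z j
    have h5 : Q * ρ j = 4 * supNorm z / (1 - ‖w j‖ ^ 2) := by
      simp only [hQ, hρ]
      rw [← mul_div_assoc]
      congr 1
      linear_combination 2 * supNorm z * h2
    rw [h5, le_div_iff₀ (one_sub_sq_pos hw j)]
    linarith
  set c : ℝ := 2 / ((n : ℝ) + 1) with hc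
  have hc0 : 0 ≤ c := by positivity
  have hnc : n * c ≤ 2 := by
    rw [hc, ← mul_div_assoc, div_le_iff₀ (by positivity)]
    linarith
  have hk : ∀ k, bergmanScale w (autSchwarzian z w v) k
      = u k * (p k / ρ k * u k - c * ∑ j, p j / ρ j * u j) := by
    intro k
    have e : ∀ j, p j / ρ j * u j = p j * v j := by
      intro j
      rw [huk]
      field_simp [hρne j]
    simp only [e]
    rw [huk]
    have e2 : (c : ℂ) = 2 / ((n : ℂ) + 1) := by rw [hc]; push_cast; rfl
    rw [e2]
    change (ρ k : ℂ) * (p k * v k ^ 2 - 2 / ((n : ℂ) + 1) * v k * ∑ j, p j * v j) = _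
    ring
  rw [bergmanNorm_eq]
  refine abs_le_of_sq_le_sq' ?_ hQ0 |>.2
  rw [EuclideanSpace.norm_sq_eq]
  calc ∑ k, ‖bergmanScale w (autSchwarzian z w v) k‖ ^ 2 ≤ ∑ k, ‖u k‖ ^ 2 * Q ^ 2 := by
        refine Finset.sum_le_sum fun k _ => ?_
        rw [hk, norm_mul, mul_pow]
        gcongr
        exact norm_sub_mean_le hus hq hQ0 hc0 hnc k
    _ = Q ^ 2 := by rw [← Finset.sum_mul, hus, one_mul]

end PolydiskAutomorphism

/-! ### The Koebe transform and the chain rule for the Schwarzian -/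

/-- The composition of `f` with a polydisk automorphism on the right and the affine map
`x ↦ B (x - f z)` on the left. -/
def affineTransform (f : Cn n → Cn n) (z : Cn n) (B : Matrix (Fin n) (Fin n) ℂ) (w : Cn n) : Cn n :=
  WithLp.toLp 2 (B.mulVec fun l => f (polydiskAut z w) l - f z l)

section AffineTransform

variable {f : Cn n → Cn n} {z w : Cn n} {B : Matrix (Fin n) (Fin n) ℂ}

theorem affineTransform_apply (l : Fin n) : affineTransform f z B w l
    = ∑ m, B l m * (f (polydiskAut z w) m - f z m) := rfl

theorem analyticAt_comp_polydiskAut {h : Cn n → ℂ} (hz : z ∈ polydisk n) (hw : w ∈ polydisk n)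
    (hh : AnalyticAt ℂ h (polydiskAut z w)) : AnalyticAt ℂ (fun w => h (polydiskAut z w)) w :=
  hh.comp (analyticAt_polydiskAut hz hw)

theorem analyticOnNhd_affineTransform (hf : IsLocallyBiholomorphic f) (hz : z ∈ polydisk n) :
    AnalyticOnNhd ℂ (affineTransform f z B) (polydisk n) := fun _ hw =>
  analyticAt_toLp fun _ => Finset.analyticAt_fun_sum Finset.univ fun m _ =>
    analyticAt_const.fun_mul ((analyticAt_comp_polydiskAut hz hw
      ((hf.1 _ (polydiskAut_mem hz hw)).coord m)).fun_sub analyticAt_const)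

theorem partialDeriv_affineTransform (hf : IsLocallyBiholomorphic f) (hz : z ∈ polydisk n)
    (hw : w ∈ polydisk n) (j l : Fin n) :
    partialDeriv j (fun w => affineTransform f z B w l) w
      = ∑ m, B l m * (partialDeriv j (fun w => f w m) (polydiskAut z w)
          * diskAutDeriv (z j) (w j)) := by
  have han := fun m => (hf.1 _ (polydiskAut_mem hz hw)).coord m
  have hd := fun m => (analyticAt_comp_polydiskAut hz hw (han m)).differentiableAt
  simp only [affineTransform_apply]
  rw [partialDeriv_sum _ fun m _ => ((hd m).sub_const _).const_mul _]
  refine Finset.sum_congr rfl fun m _ => ?_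
  rw [partialDeriv_const_mul _ ((hd m).sub_const _),
    partialDeriv_sub (hd m) (differentiableAt_const _), partialDeriv_const, sub_zero,
    partialDeriv_comp_polydiskAut hz hw (han m).differentiableAt]

theorem jacobianMatrix_affineTransform (hf : IsLocallyBiholomorphic f) (hz : z ∈ polydisk n)
    (hw : w ∈ polydisk n) : jacobianMatrix (affineTransform f z B) w
      = B * (jacobianMatrix f (polydiskAut z w)
          * Matrix.diagonal fun j => diskAutDeriv (z j) (w j)) := by
  ext l j
  rw [Matrix.mul_apply]
  simp only [jacobianMatrix, Matrix.of_apply, partialDeriv_affineTransform hf hz hw,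
    Matrix.mul_diagonal]

theorem jac_affineTransform (hf : IsLocallyBiholomorphic f) (hz : z ∈ polydisk n)
    (hw : w ∈ polydisk n) : jac (affineTransform f z B) w
      = B.det * (jac f (polydiskAut z w) * ∏ j, diskAutDeriv (z j) (w j)) := by
  rw [jac, jacobianMatrix_affineTransform hf hz hw, Matrix.det_mul, Matrix.det_mul,
    Matrix.det_diagonal, jac]

theorem isLocallyBiholomorphic_affineTransform (hf : IsLocallyBiholomorphic f)
    (hz : z ∈ polydisk n) (hB : B.det ≠ 0) :
    IsLocallyBiholomorphic (affineTransform f z B) := by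
  refine ⟨analyticOnNhd_affineTransform hf hz, fun w hw => ?_⟩
  rw [jac_affineTransform hf hz hw]
  exact mul_ne_zero hB (mul_ne_zero (hf.2 _ (polydiskAut_mem hz hw))
    (Finset.prod_ne_zero_iff.2 fun j _ => diskAutDeriv_ne_zero (hz j) (hw j)))

theorem partialDeriv_jac_affineTransform (hf : IsLocallyBiholomorphic f) (hz : z ∈ polydisk n)
    (hw : w ∈ polydisk n) (i : Fin n) : partialDeriv i (jac (affineTransform f z B)) w
      = B.det * ((partialDeriv i (jac f) (polydiskAut z w) * diskAutDeriv (z i) (w i)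
          + jac f (polydiskAut z w) * diskAutLogDeriv (z i) (w i))
            * ∏ j, diskAutDeriv (z j) (w j)) := by
  have hJ := analyticAt_jac (hf.1 _ (polydiskAut_mem hz hw))
  have hd := (analyticAt_comp_polydiskAut hz hw hJ).differentiableAt
  have hp : DifferentiableAt ℂ (fun w : Cn n => ∏ j, diskAutDeriv (z j) (w j)) w :=
    (HasFDerivAt.finsetProd fun j _ =>
      (differentiableAt_diskAutDeriv hz hw j).hasFDerivAt).differentiableAt
  rw [partialDeriv_congr (Filter.eventuallyEq_of_mem ((isOpen_polydisk n).mem_nhds hw)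
      fun w hw => jac_affineTransform hf hz hw),
    partialDeriv_const_mul _ (hd.fun_mul hp), partialDeriv_mul hd hp,
    partialDeriv_prod_diskAutDeriv hz hw, partialDeriv_comp_polydiskAut hz hw hJ.differentiableAt]
  ring

theorem logJacGrad_affineTransform (hf : IsLocallyBiholomorphic f) (hz : z ∈ polydisk n)
    (hB : B.det ≠ 0) (hw : w ∈ polydisk n) (i : Fin n) : logJacGrad (affineTransform f z B) i w
      = logJacGrad f i (polydiskAut z w) * diskAutDeriv (z i) (w i)
        + 1 / ((n : ℂ) + 1) * diskAutLogDeriv (z i) (w i) := by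
  have h1 := hf.2 _ (polydiskAut_mem hz hw)
  have h2 : ∏ j, diskAutDeriv (z j) (w j) ≠ 0 :=
    Finset.prod_ne_zero_iff.2 fun j _ => diskAutDeriv_ne_zero (hz j) (hw j)
  simp only [logJacGrad]
  rw [partialDeriv_jac_affineTransform hf hz hw, jac_affineTransform hf hz hw]
  field_simp

theorem christoffel_affineTransform (hf : IsLocallyBiholomorphic f) (hz : z ∈ polydisk n)
    (hB : B.det ≠ 0) (hw : w ∈ polydisk n) (k i j : Fin n) :
    christoffel (affineTransform f z B) k i j w = (diskAutDeriv (z k) (w k))⁻¹ *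
      (christoffel f k i j (polydiskAut z w) * diskAutDeriv (z i) (w i) * diskAutDeriv (z j) (w j)
        + if k = j then (if j = i then
            diskAutDeriv (z j) (w j) * diskAutLogDeriv (z j) (w j) else 0) else 0) := by
  have hm := polydiskAut_mem hz hw
  have hG := (isLocallyBiholomorphic_affineTransform hf hz hB).2 w hw
  have hdet : IsUnit (jacobianMatrix (affineTransform f z B) w).det := isUnit_iff_ne_zero.2 hG
  set X : Fin n → ℂ := fun l =>
    partialDeriv i (partialDeriv j fun x => affineTransform f z B x l) w with hX
  set Z : Fin n → ℂ := fun k => (diskAutDeriv (z k) (w k))⁻¹ *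
      (christoffel f k i j (polydiskAut z w) * diskAutDeriv (z i) (w i) * diskAutDeriv (z j) (w j)
        + if k = j then (if j = i then
            diskAutDeriv (z j) (w j) * diskAutLogDeriv (z j) (w j) else 0) else 0) with hZ
  have e : christoffel (affineTransform f z B) k i j w
      = ((jacobianMatrix (affineTransform f z B) w)⁻¹.mulVec X) k := by
    simp only [christoffel, Matrix.mulVec, dotProduct, hX]
    exact Finset.sum_congr rfl fun l _ => mul_comm _ _
  -- Verifying that the Jacobian matrix sends the claimed symbols `Z` to the second derivatives `X`
  -- avoids computing the inverse of a product.
  have hXZ : X = (jacobianMatrix (affineTransform f z B) w).mulVec Z := by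
    rw [jacobianMatrix_affineTransform hf hz hw, ← Matrix.mulVec_mulVec, ← Matrix.mulVec_mulVec]
    funext l
    have hd := fun m => (hf.1 _ hm).coord m |>.partialDeriv j
    have hd' := fun m => (analyticAt_comp_polydiskAut hz hw (hd m)).differentiableAt
    have hD := differentiableAt_diskAutDeriv hz hw j
    simp only [hX]
    rw [partialDeriv_congr (Filter.eventuallyEq_of_mem ((isOpen_polydisk n).mem_nhds hw)
      fun w hw => partialDeriv_affineTransform hf hz hw j l),
      partialDeriv_sum _ fun m _ => ((hd' m).fun_mul hD).const_mul _]
    simp only [Matrix.mulVec, dotProduct]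
    refine Finset.sum_congr rfl fun m _ => ?_
    rw [partialDeriv_const_mul _ ((hd' m).fun_mul hD), partialDeriv_mul (hd' m) hD,
      partialDeriv_comp_polydiskAut hz hw (hd m).differentiableAt,
      partialDeriv_diskAutDeriv hz hw, partialDeriv_partialDeriv_eq (hf.2 _ hm)]
    congr 1
    have e2 : ∀ x, ∑ y, Matrix.diagonal (fun j => diskAutDeriv (z j) (w j)) x y * Z y
        = christoffel f x i j (polydiskAut z w) * diskAutDeriv (z i) (w i)
            * diskAutDeriv (z j) (w j)
          + if x = j then (if j = i then
            diskAutDeriv (z j) (w j) * diskAutLogDeriv (z j) (w j) else 0) else 0 := by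
      intro x
      simp only [Matrix.diagonal_apply, ite_mul, zero_mul, Finset.sum_ite_eq, Finset.mem_univ,
        if_true, hZ]
      rw [mul_inv_cancel_left₀ (diskAutDeriv_ne_zero (hz x) (hw x))]
    simp only [e2, mul_add, Finset.sum_add_distrib, mul_ite, mul_zero, Finset.sum_ite_eq',
      Finset.mem_univ, if_true, jacobianMatrix, Matrix.of_apply]
    congr 1
    rw [Finset.sum_mul, Finset.sum_mul]
    exact Finset.sum_congr rfl fun x _ => by ring
  rw [e, hXZ, Matrix.mulVec_mulVec, Matrix.nonsing_inv_mul _ hdet, Matrix.one_mulVec]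

theorem schwarzianCoeff_affineTransform (hf : IsLocallyBiholomorphic f) (hz : z ∈ polydisk n)
    (hB : B.det ≠ 0) (hw : w ∈ polydisk n) (k i j : Fin n) :
    schwarzianCoeff (affineTransform f z B) k i j w = (diskAutDeriv (z k) (w k))⁻¹ *
        (schwarzianCoeff f k i j (polydiskAut z w)
          * diskAutDeriv (z i) (w i) * diskAutDeriv (z j) (w j))
      + ((if k = j then (if j = i then diskAutLogDeriv (z j) (w j) else 0) else 0)
        - 1 / ((n : ℂ) + 1) * ((if k = i then diskAutLogDeriv (z j) (w j) else 0)
          + (if k = j then diskAutLogDeriv (z i) (w i) else 0))) := by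
  have hk := diskAutDeriv_ne_zero (hz k) (hw k)
  rw [schwarzianCoeff_eq, schwarzianCoeff_eq, christoffel_affineTransform hf hz hB hw,
    logJacGrad_affineTransform hf hz hB hw, logJacGrad_affineTransform hf hz hB hw]
  by_cases hki : k = i <;> by_cases hkj : k = j
  · subst hki; subst hkj
    simp only [if_true]
    field_simp
    ring
  · subst hki
    simp only [if_true, if_neg hkj]
    field_simp
    ring
  · subst hkj
    simp only [if_true, if_neg hki]
    field_simp
    ring
  · simp only [if_neg hki, if_neg hkj]
    ring

/-- Chain rule `S_{f∘φ}(v) = Dφ⁻¹ S_f(Dφ v) + S_φ(v)`, with `φ` the polydisk automorphism; the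
affine map on the left has no effect. -/
theorem schwarzian_affineTransform (hf : IsLocallyBiholomorphic f) (hz : z ∈ polydisk n)
    (hB : B.det ≠ 0) (hw : w ∈ polydisk n) (v : Cn n) :
    schwarzian (affineTransform f z B) w v = WithLp.toLp 2 (fun k =>
        (diskAutDeriv (z k) (w k))⁻¹ * schwarzian f (polydiskAut z w)
          (WithLp.toLp 2 fun i => diskAutDeriv (z i) (w i) * v i) k)
      + autSchwarzian z w v := by
  ext k
  simp only [PiLp.add_apply, autSchwarzian, schwarzian, Finset.mul_sum]
  simp only [schwarzianCoeff_affineTransform hf hz hB hw, add_mul, sub_mul,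
    Finset.sum_add_distrib, Finset.sum_sub_distrib, mul_add, mul_ite, ite_mul, mul_zero, zero_mul,
    Finset.sum_ite_eq, Finset.mem_univ, if_true]
  have e : ∀ (q : Fin n → ℂ), ∑ i, ∑ j, (if k = i then q j * v i * v j else 0)
      = ∑ j, q j * v k * v j := fun q => by
    rw [Finset.sum_comm]
    simp
  congr 1
  · refine Finset.sum_congr rfl fun i _ => Finset.sum_congr rfl fun j _ => by ring
  · rw [e, ← Finset.sum_add_distrib, sq, mul_assoc]
    congr 1
    exact Finset.sum_congr rfl fun i _ => by ring

/-- The automorphism is a Bergman isometry, so the first term of the chain rule contributes at most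
`α` and its own Schwarzian at most `2√2 |z|_∞`. The condition on `B` normalizes the derivative at
`0`. -/
theorem affineTransform_mem_family {α : ℝ} (hα : 0 ≤ α) (hf : f ∈ family n α)
    (hz : z ∈ polydisk n) (hB : B * (jacobianMatrix f z
      * Matrix.diagonal fun j => diskAutDeriv (z j) 0) = 1) :
    affineTransform f z B ∈ family n (α + 2 * Real.sqrt 2 * supNorm z) := by
  have h0 := zero_mem_polydisk n
  have hBdet : B.det ≠ 0 := left_ne_zero_of_mul_eq_one (by rw [← Matrix.det_mul, hB, Matrix.det_one])
  have hG := isLocallyBiholomorphic_affineTransform hf.1 hz hBdet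
  have hβ : 0 ≤ α + 2 * Real.sqrt 2 * supNorm z := by
    have := supNorm_nonneg z
    positivity
  refine ⟨hG, ?_, ?_, (schwarzianNorm_le_iff hβ).2 fun w hw v hv => ?_⟩
  · ext l
    simp [affineTransform_apply, polydiskAut_zero]
  · have hM : jacobianMatrix (affineTransform f z B) 0 = 1 := by
      rw [jacobianMatrix_affineTransform hf.1 hz h0, polydiskAut_zero]
      exact hB
    ext v l
    rw [fderiv_apply_coord (hG.1 0 h0).differentiableAt]
    have e : ∀ i, partialDeriv i (fun w => affineTransform f z B w l) 0 = if l = i then 1 else 0 :=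
      fun i => congrFun (congrFun hM l) i
    simp [e]
  · rw [schwarzian_affineTransform hf.1 hz hBdet hw]
    refine (bergmanNorm_add_le _ _ _).trans (add_le_add ?_ (bergmanNorm_autSchwarzian_le hz hw hv))
    rw [← bergmanNorm_polydiskAut (u := schwarzian f (polydiskAut z w)
      (WithLp.toLp 2 fun i => diskAutDeriv (z i) (w i) * v i)) hz hw fun k =>
        (mul_inv_cancel_left₀ (diskAutDeriv_ne_zero (hz k) (hw k)) _).symm]
    refine (bergmanNorm_schwarzian_le hα hf (polydiskAut_mem hz hw) _).trans ?_
    rw [bergmanNorm_polydiskAut (v := v) hz hw fun i => rfl, hv]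
    simp

end AffineTransform

/-! ### Covering and distortion at a general point -/

section Distortion

variable {f : Cn n → Cn n} {z : Cn n}

theorem diskAutDeriv_zero (a : ℂ) : diskAutDeriv a 0 = ((1 - ‖a‖ ^ 2 : ℝ) : ℂ) := by
  simp [diskAutDeriv]

theorem diskAutLogDeriv_zero (a : ℂ) : diskAutLogDeriv a 0 = -2 * star a := by
  simp [diskAutLogDeriv]

theorem minStretch_mul_le (f : Cn n → Cn n) (z v : Cn n) :
    minStretch f z * ‖v‖ ≤ ‖fderiv ℂ f z v‖ := by
  rcases eq_or_ne v 0 with rfl | hv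
  · simp
  have hv' : 0 < ‖v‖ := norm_pos_iff.2 hv
  have hb : BddBelow ((fun v => ‖fderiv ℂ f z v‖) '' Metric.sphere (0 : Cn n) 1) :=
    ⟨0, by rintro _ ⟨u, _, rfl⟩; exact norm_nonneg _⟩
  have hn : ‖((‖v‖⁻¹ : ℝ) : ℂ)‖ = ‖v‖⁻¹ := by
    rw [Complex.norm_real, Real.norm_eq_abs, abs_of_pos (by positivity)]
  have h := csInf_le hb ⟨((‖v‖⁻¹ : ℝ) : ℂ) • v, by
    rw [mem_sphere_zero_iff_norm, norm_smul, hn, inv_mul_cancel₀ hv'.ne'], rfl⟩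
  simp only [map_smul, norm_smul, hn] at h
  rwa [inv_mul_eq_div, le_div_iff₀ hv'] at h

theorem exists_left_inverse_jacobianMatrix (hf : IsLocallyBiholomorphic f) (hz : z ∈ polydisk n) :
    ∃ B : Matrix (Fin n) (Fin n) ℂ, B * (jacobianMatrix f z
      * Matrix.diagonal fun j => diskAutDeriv (z j) 0) = 1 := by
  refine ⟨_, Matrix.nonsing_inv_mul _ (isUnit_iff_ne_zero.2 ?_)⟩
  rw [Matrix.det_mul, Matrix.det_diagonal]
  exact mul_ne_zero (hf.2 z hz) (Finset.prod_ne_zero_iff.2 fun j _ =>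
    diskAutDeriv_ne_zero (hz j) (by simp))

/-- The transform sends the target `y` to `x = B (y - f z)`. With `t = Dφ(0) x` one has `Df(z) t = y
- f z`, hence `(1 - |z|_∞) η(z) |x| ≤ η(z) |t| ≤ |y - f z|`. So `|x|` is below half the covering
radius for `β`, and the result at the origin applies. -/
theorem ball_subset_image {α : ℝ} (hα : 0 ≤ α) (hf : f ∈ family n α) (hz : z ∈ polydisk n) :
    Metric.ball (f z) (1 / 2 * (1 - supNorm z) * minStretch f z
      * coveringRadius n (α + 2 * Real.sqrt 2 * supNorm z)) ⊆ f '' polydisk n := by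
  obtain ⟨B, hB⟩ := exists_left_inverse_jacobianMatrix hf.1 hz
  have hB' := mul_eq_one_comm.1 hB
  have hd := (hf.1.1 z hz).differentiableAt
  intro y hy
  rw [mem_ball_iff_norm] at hy
  set s := coveringRadius n (α + 2 * Real.sqrt 2 * supNorm z) with hs
  set x : Cn n := WithLp.toLp 2 (B.mulVec fun l => y l - f z l) with hx
  set t : Cn n := WithLp.toLp 2 fun j => diskAutDeriv (z j) 0 * x j with ht
  have hyt : fderiv ℂ f z t = y - f z := by
    have e1 : (jacobianMatrix f z * Matrix.diagonal fun j => diskAutDeriv (z j) 0).mulVec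
        (B.mulVec fun l => y l - f z l) = fun l => y l - f z l := by
      rw [Matrix.mulVec_mulVec, hB', Matrix.one_mulVec]
    ext l
    have e2 := congrFun e1 l
    rw [fderiv_apply_coord hd, PiLp.sub_apply, ← e2, ← Matrix.mulVec_mulVec]
    refine Finset.sum_congr rfl fun i _ => ?_
    rw [Matrix.mulVec_diagonal, mul_comm]
    rfl
  have hM0 := supNorm_nonneg z
  have hM1 := supNorm_lt_one hz
  have hxt : (1 - supNorm z) * ‖x‖ ≤ ‖t‖ := by
    refine abs_le_of_sq_le_sq' ?_ (norm_nonneg _) |>.2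
    rw [mul_pow, EuclideanSpace.norm_sq_eq, EuclideanSpace.norm_sq_eq, Finset.mul_sum]
    refine Finset.sum_le_sum fun j _ => ?_
    have hj := norm_coord_le_supNorm z j
    have hpos := one_sub_sq_pos hz j
    rw [← mul_pow]
    simp only [ht, norm_mul, diskAutDeriv_zero, Complex.norm_real, Real.norm_eq_abs]
    rw [abs_of_pos hpos]
    -- What remains is `1 - |z|_∞ ≤ 1 - |z_j| ^ 2`, true because `|z_j| ^ 2 ≤ |z_j| ≤ |z|_∞`.
    gcongr
    nlinarith [norm_nonneg (z j)]
  have hη0 : 0 ≤ minStretch f z := Real.sInf_nonneg (by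
    rintro _ ⟨u, _, rfl⟩
    exact norm_nonneg _)
  have h1 := minStretch_mul_le f z t
  rw [hyt] at h1
  have hlt : (1 - supNorm z) * minStretch f z * ‖x‖ < (1 - supNorm z) * minStretch f z * (s / 2) := by
    have := mul_le_mul_of_nonneg_left hxt hη0
    linarith
  have hxs : ‖x‖ < s / 2 := lt_of_mul_lt_mul_left hlt (mul_nonneg (by linarith) hη0)
  obtain ⟨ζ, hζ, he⟩ := ball_half_coveringRadius_subset
    (affineTransform_mem_family hα hf hz hB) (mem_ball_zero_iff.2 hxs)
  refine ⟨polydiskAut z ζ, polydiskAut_mem hz hζ, ?_⟩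
  have e3 := congrArg (fun v : Cn n =>
    (jacobianMatrix f z * Matrix.diagonal fun j => diskAutDeriv (z j) 0).mulVec v.ofLp) he
  simp only [affineTransform, hx, Matrix.mulVec_mulVec, hB', Matrix.one_mulVec] at e3
  ext l
  have := congrFun e3 l
  exact sub_left_injective this

/-- For the transform `G`, differentiating `J_G` at `0`, where `J_G(0) = 1`, gives `∂_i J_G(0) = (1
- |z_i|²) ∂_i J_f(z) / J_f(z) - 2 conj(z_i)`. The left side is at most `λ_β` in modulus; solving for
`∂_i J_f(z)` gives the estimate. -/
theorem supNorm_gradJac_le (hn : 2 ≤ n) {α : ℝ} (hα : 0 ≤ α) (hf : f ∈ family n α)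
    (hz : z ∈ polydisk n) : supNorm (gradJac f z)
      ≤ (order n (α + 2 * Real.sqrt 2 * supNorm z) + 2 * supNorm z) / (1 - supNorm z ^ 2)
        * ‖jac f z‖ := by
  obtain ⟨B, hB⟩ := exists_left_inverse_jacobianMatrix hf.1 hz
  have hM0 := supNorm_nonneg z
  have hM1 := supNorm_lt_one hz
  have hM2 : 0 < 1 - supNorm z ^ 2 := by nlinarith
  have h0 := zero_mem_polydisk n
  have hG := affineTransform_mem_family hα hf hz hB
  set β := α + 2 * Real.sqrt 2 * supNorm z with hβ
  have hβ0 : 0 ≤ β := by positivity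
  have hle : ‖gradJac (affineTransform f z B) 0‖ ≤ order n β :=
    le_csSup (bddAbove_orderSet hn hβ0) ⟨_, hG, rfl⟩
  have hord : 0 ≤ order n β := (norm_nonneg _).trans hle
  have hJ0 := hf.1.2 z hz
  have hJG := jac_zero_of_mem_family hG
  rw [jac_affineTransform hf.1 hz h0, polydiskAut_zero] at hJG
  refine supNorm_le (by positivity) fun i => ?_
  have hi := norm_coord_le_supNorm z i
  have hpos := one_sub_sq_pos hz i
  have e : gradJac (affineTransform f z B) 0 i * jac f z
      = partialDeriv i (jac f) z * ((1 - ‖z i‖ ^ 2 : ℝ) : ℂ) + jac f z * (-2 * star (z i)) := by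
    have := partialDeriv_jac_affineTransform (B := B) hf.1 hz h0 i
    rw [polydiskAut_zero] at this
    change partialDeriv i (jac (affineTransform f z B)) 0 * _ = _
    rw [this, PiLp.zero_apply, diskAutDeriv_zero, diskAutLogDeriv_zero]
    linear_combination (partialDeriv i (jac f) z * ((1 - ‖z i‖ ^ 2 : ℝ) : ℂ)
      + jac f z * (-2 * star (z i))) * hJG
  have h1 : ‖partialDeriv i (jac f) z‖ * (1 - ‖z i‖ ^ 2)
      ≤ (order n β + 2 * ‖z i‖) * ‖jac f z‖ := by
    have e2 : partialDeriv i (jac f) z * ((1 - ‖z i‖ ^ 2 : ℝ) : ℂ)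
        = gradJac (affineTransform f z B) 0 i * jac f z + 2 * star (z i) * jac f z := by
      rw [e]; ring
    have h2 : ‖partialDeriv i (jac f) z * ((1 - ‖z i‖ ^ 2 : ℝ) : ℂ)‖
        = ‖partialDeriv i (jac f) z‖ * (1 - ‖z i‖ ^ 2) := by
      rw [norm_mul, Complex.norm_real, Real.norm_eq_abs, abs_of_pos hpos]
    have h3 : ‖(2 : ℂ)‖ = 2 := by simp
    rw [← h2, e2, add_mul]
    refine (norm_add_le _ _).trans (add_le_add ?_ (le_of_eq ?_))
    · rw [norm_mul]
      gcongr
      exact (PiLp.norm_apply_le _ i).trans hle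
    · rw [norm_mul, norm_mul, norm_star, h3]
  change ‖partialDeriv i (jac f) z‖ ≤ _
  rw [div_mul_eq_mul_div, le_div_iff₀ hM2]
  calc ‖partialDeriv i (jac f) z‖ * (1 - supNorm z ^ 2)
      ≤ ‖partialDeriv i (jac f) z‖ * (1 - ‖z i‖ ^ 2) := by gcongr
    _ ≤ (order n β + 2 * ‖z i‖) * ‖jac f z‖ := h1
    _ ≤ _ := by gcongr

end Distortion

end PolydiskSchwarzian

end

theorem theorem3p12 (n : ℕ) (hn : 2 ≤ n) (α : ℝ) (hα : 0 ≤ α)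
    (f : PolydiskSchwarzian.Cn n → PolydiskSchwarzian.Cn n)
    (hf : f ∈ PolydiskSchwarzian.family n α)
    (z : PolydiskSchwarzian.Cn n) (hz : z ∈ PolydiskSchwarzian.polydisk n)
    (β : ℝ) (hβ : β = α + 2 * Real.sqrt 2 * PolydiskSchwarzian.supNorm z) :
    (0 < PolydiskSchwarzian.coveringRadius n β ∧
      Metric.ball (f z)
          (1 / 2 * (1 - PolydiskSchwarzian.supNorm z) * PolydiskSchwarzian.minStretch f z
            * PolydiskSchwarzian.coveringRadius n β)
        ⊆ f '' PolydiskSchwarzian.polydisk n) ∧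
    (BddAbove (PolydiskSchwarzian.orderSet n β) ∧
      PolydiskSchwarzian.supNorm (PolydiskSchwarzian.gradJac f z)
        ≤ (PolydiskSchwarzian.order n β + 2 * PolydiskSchwarzian.supNorm z)
            / (1 - PolydiskSchwarzian.supNorm z ^ 2) * ‖PolydiskSchwarzian.jac f z‖) := by
  have hβ0 : 0 ≤ β := by
    have := PolydiskSchwarzian.supNorm_nonneg z
    rw [hβ]
    positivity
  subst hβ
  exact ⟨⟨PolydiskSchwarzian.coveringRadius_pos hn hβ0,
    PolydiskSchwarzian.ball_subset_image hα hf hz⟩,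
    PolydiskSchwarzian.bddAbove_orderSet hn hβ0, PolydiskSchwarzian.supNorm_gradJac_le hn hα hf hz⟩
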